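/- Let $\Gamma$ be a finite tree with at least one edge and let $n\ge 0$. A cell of $\Gamma$ is a vertex or a closed edge. Let $D^n\Gamma\subseteq\prod^n\Gamma$ be the union of the products of open cells $c_1\times\dots\times c_n$ whose closures are pairwise disjoint ($\overline{c_i}\cap\overline{c_j}=\emptyset$ for $i\ne j$), and let $\mathcal{UD}^n\Gamma=D^n\Gamma/S_n$, where $S_n$ permutes the coordinates. A cell of $\mathcal{UD}^n\Gamma$ is a set $c=\{c_1,\dots,c_n\}$ of $n$ pairwise disjoint closed cells of $\Gamma$; its dimension is the number of edges in it. A vertex $v$ is essential if its degree $d(v)$ is at least $3$. Fix a vertex $*$ of degree $1$ as root. For each vertex $v\neq *$ label the $d(v)$ edges at $v$ bijectively by $0,\dots,d(v)-1$, with $0$ labelling the edge leading towards $*$; label the edge at $*$ by $1$. For $u\neq v$ let $g(u,v)$ be the label at $u$ of the first edge of the geodesic from $u$ to $v$, and put $g(u,u)=0$. Let $u\wedge v$ be the vertex of $[*,u]\cap[*,v]$ farthest from $*$, and order the vertices by: $u\le v$ if and only if $m=u$, or $m\neq u$ and $g(m,u)<g(m,v)$, where $m=u\wedge v$. For $v\ne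 *$ let $e(v)$ be the edge at $v$ closest to $*$. A vertex $v\ne *$ of a cell $c$ is unblocked in $c$ if $e(v)$ is disjoint from every other member of $c$; the root is never unblocked. If $c$ has an unblocked vertex, its principal reduction is the cell obtained from $c$ by replacing the smallest unblocked vertex $v$ by $e(v)$. Define partial functions $W_i$ from $i$-cells to $(i+1)$-cells inductively: $W_0(c)$ is the principal reduction of $c$ if it exists; for $i>0$, $W_i(c)$ is the principal reduction of $c$ if it exists and $c\notin\operatorname{im}W_{i-1}$; otherwise $W_i(c)$ is undefined. A cell is redundant if it lies in the domain of some $W_i$, collapsible if it lies in the image of some $W_i$, and critical if it is neither. Let $(\mathcal{UD}^n\Gamma)'_k$ be the $k$-skeleton of $\mathcal{UD}^n\Gamma$ with the redundant (open) $k$-cells removed. **Theorem.** For every choice of root and labels as above, let $$k=\min\left\{\left\lfloor \frac n2\right\rfloor,\ \#\{v : v \text{ an essential vertex of } \Gamma\}\right\}.$$ Then every critical cell $c$ of $\mathcal{UD}^n\Gamma$ satisfies $\dim c\le k$, and $\mathcal{UD}^n\Gamma$ strong deformation retracts onto $(\mathcal{UD}^n\Gamma)'_k$. -/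

import Mathlib

/-- The closed cells of a simple graph, each given by its finite set of vertices: a vertex `v` is
`{v}`, an edge with endpoints `u`, `w` is `{u, w}`. Two closed cells intersect if and only if they
share a vertex. -/
def IsGraphCell {V : Type*} [DecidableEq V] (Γ : SimpleGraph V) (s : Finset V) : Prop :=
  (∃ v, s = {v}) ∨ ∃ u w, Γ.Adj u w ∧ s = {u, w}

/-! ### The topological space `UDⁿΓ` -/

/-- The carrier of a point given in barycentric coordinates: the vertices with nonzero weight. -/
noncomputable def carrier {V : Type*} [Fintype V] (x : V → ℝ) : Finset V :=
  Finset.univ.filter fun v => x v ≠ 0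

/-- The geometric realization of a finite graph: a vertex `v` is the point with weight `1` on `v`,
and an interior point of the edge `{u, w}` has positive weights `1 - t`, `t` on `u`, `w`.
It carries the subspace topology of `V → ℝ`. -/
abbrev Realization {V : Type*} [Fintype V] [DecidableEq V] (Γ : SimpleGraph V) : Type _ :=
  {x : V → ℝ // x ∈ stdSimplex ℝ V ∧ IsGraphCell Γ (carrier x)}

/-- The smallest closed cell of the realization which contains the point `x`, i.e. the closure of
the open cell in which `x` lies. -/
def closedCellOf {V : Type*} [Fintype V] [DecidableEq V] {Γ : SimpleGraph V}
    (x : Realization Γ) : Set (Realization Γ) :=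
  {y | carrier y.1 ⊆ carrier x.1}

/-- The labelled discretized configuration space `DⁿΓ`, a subspace of the product `∏ⁿ Γ`: the union
of the open cells `c₁ × ⋯ × cₙ` such that the closures of `cᵢ` and `cⱼ` are disjoint for all
`i ≠ j` (that is, whose closure does not meet the diagonal). -/
abbrev DConf {V : Type*} [Fintype V] [DecidableEq V] (Γ : SimpleGraph V) (n : ℕ) : Type _ :=
  {x : Fin n → Realization Γ // ∀ i j, i ≠ j → Disjoint (closedCellOf (x i)) (closedCellOf (x j))}

/-- Two labelled configurations are equivalent if they differ by a permutation of the factors. -/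
def permSetoid {V : Type*} [Fintype V] [DecidableEq V] (Γ : SimpleGraph V) (n : ℕ) :
    Setoid (DConf Γ n) where
  r x y := ∃ σ : Equiv.Perm (Fin n), ∀ i, y.1 i = x.1 (σ i)
  iseqv :=
    { refl := fun _ => ⟨1, fun _ => rfl⟩
      symm := fun {x y} ⟨σ, h⟩ => ⟨σ⁻¹, fun i => by simp [h]⟩
      trans := fun {x y z} ⟨σ, h⟩ ⟨ρ, h'⟩ => ⟨σ * ρ, fun i => by simp [h, h']⟩ }

/-- The unlabelled discretized configuration space `UDⁿΓ`, the quotient of `DⁿΓ` by the action of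
the symmetric group, with the quotient topology. -/
abbrev UDConf {V : Type*} [Fintype V] [DecidableEq V] (Γ : SimpleGraph V) (n : ℕ) : Type _ :=
  Quotient (permSetoid Γ n)

/-! ### The cells of `UDⁿΓ` -/

/-- A cell `{c₁, …, cₙ}` of `UDⁿΓ`: a set of `n` pairwise disjoint closed cells of the graph. -/
@[ext]
structure UDCell {V : Type*} [DecidableEq V] (Γ : SimpleGraph V) (n : ℕ) where
  cells : Finset (Finset V)
  isGraphCell : ∀ s ∈ cells, IsGraphCell Γ s
  disjoint : ∀ s ∈ cells, ∀ t ∈ cells, s ≠ t → Disjoint s t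
  card_cells : cells.card = n

/-- The dimension of a cell of `UDⁿΓ` is the number of edges in it. -/
def UDCell.dim {V : Type*} [DecidableEq V] {Γ : SimpleGraph V} {n : ℕ} (c : UDCell Γ n) : ℕ :=
  (c.cells.filter fun s => s.card = 2).card

/-- The open cell of the space `UDⁿΓ` given by `c`: all configurations whose points lie in the
open cells `c₁, …, cₙ` of the graph, one point in each. -/
def UDCell.openCell {V : Type*} [Fintype V] [DecidableEq V] {Γ : SimpleGraph V} {n : ℕ}
    (c : UDCell Γ n) : Set (UDConf Γ n) :=
  {q | ∃ x : DConf Γ n, Quotient.mk (permSetoid Γ n) x = q ∧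
    Finset.univ.image (fun i => carrier (x.1 i).1) = c.cells}

/-! ### The order on the vertices of a rooted tree -/

/-- The vertices on the geodesic from `u` to `v`. -/
def geodesic {V : Type*} (Γ : SimpleGraph V) (u v : V) : Set V :=
  {w | Γ.dist u w + Γ.dist w v = Γ.dist u v}

open Classical in
/-- The vertex following `u` on the geodesic from `u` to `v`, for `u ≠ v` in a tree
(where there is exactly one); the value at `u = v` is `u`. -/
noncomputable def nextVertex {V : Type*} (Γ : SimpleGraph V) (u v : V) : V :=
  if h : ∃ w, Γ.Adj u w ∧ Γ.dist u v = Γ.dist w v + 1 then h.choose else u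

/-- A choice of labels for the directions at each vertex `v` of a tree with root `root`. The
direction from `v` along the edge to a neighbour `w` has the label `label v w`. The `d(v)`
directions from `v ≠ root` have distinct labels in `{0, …, d(v) - 1}` with the label `0` leading
back to the root; the direction from the root has the label `1`. -/
structure DirectionLabelling {V : Type*} [Fintype V] (Γ : SimpleGraph V) [DecidableRel Γ.Adj]
    (root : V) where
  label : V → V → ℕ
  label_lt : ∀ v w, v ≠ root → Γ.Adj v w → label v w < Γ.degree v
  label_injective : ∀ v w w', Γ.Adj v w → Γ.Adj v w' → label v w = label v w' → w = w'
  label_to_root : ∀ v, v ≠ root → label v (nextVertex Γ v root) = 0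
  label_root : ∀ w, Γ.Adj root w → label root w = 1

namespace DirectionLabelling

variable {V : Type*} [Fintype V] [DecidableEq V] {Γ : SimpleGraph V} [DecidableRel Γ.Adj]
  {root : V} {n : ℕ}

open Classical in
/-- `g(u, v)`: the label of the direction from `u` on the geodesic from `u` to `v`, and `0` if
`u = v`. -/
noncomputable def g (L : DirectionLabelling Γ root) (u v : V) : ℕ :=
  if u = v then 0 else L.label u (nextVertex Γ u v)

/-- `m = u ∧ v`: the endpoint other than the root of the segment `[root, u] ∩ [root, v]`, i.e. the
vertex of this intersection which is farthest from the root. -/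
def IsMeet (_L : DirectionLabelling Γ root) (m u v : V) : Prop :=
  m ∈ geodesic Γ root u ∩ geodesic Γ root v ∧
    ∀ w ∈ geodesic Γ root u ∩ geodesic Γ root v, Γ.dist root w ≤ Γ.dist root m

/-- The order on the vertices: for `m = u ∧ v`, `u ≤ v` if and only if `m = u`, or `m ≠ u` and
`g(m, u) < g(m, v)`. -/
def vertexLE (L : DirectionLabelling Γ root) (u v : V) : Prop :=
  ∃ m, L.IsMeet m u v ∧ (m = u ∨ (m ≠ u ∧ L.g m u < L.g m v))

/-! ### The discrete vector field and critical cells -/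

/-- `e(v)`, for a vertex `v` other than the root: the edge incident with `v` and closest to the
root. -/
noncomputable def rootEdge (_L : DirectionLabelling Γ root) (v : V) : Finset V :=
  {v, nextVertex Γ v root}

/-- The vertex `v` of the cell `c` is unblocked in `c`: `e(v)` exists and is disjoint from all
other members of `c`. (There is no `e(root)`, so the root is always blocked.) -/
def Unblocked (L : DirectionLabelling Γ root) (c : UDCell Γ n) (v : V) : Prop :=
  {v} ∈ c.cells ∧ v ≠ root ∧ ∀ s ∈ c.cells, s ≠ {v} → Disjoint (L.rootEdge v) s

/-- `c'` is the elementary reduction of `c` from `v`: the vertex `v` is unblocked in `c`, and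
`c'` arises from `c` when `v` is replaced by `e(v)`. -/
def IsElementaryReduction (L : DirectionLabelling Γ root) (c : UDCell Γ n) (v : V)
    (c' : UDCell Γ n) : Prop :=
  L.Unblocked c v ∧ c'.cells = insert (L.rootEdge v) (c.cells.erase {v})

/-- `c'` is the principal reduction of `c`: the elementary reduction from the smallest unblocked
vertex. -/
def IsPrincipalReduction (L : DirectionLabelling Γ root) (c c' : UDCell Γ n) : Prop :=
  ∃ v, L.IsElementaryReduction c v c' ∧ ∀ u, L.Unblocked c u → L.vertexLE v u

/-- The partial functions `Wᵢ` from `i`-cells to `(i+1)`-cells, given by their graphs: `W i c c'`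
says that `Wᵢ(c)` is defined and equal to `c'`. It is the principal reduction of `c` if that exists
and (for `i > 0`) `c` is not in the image of `Wᵢ₋₁`. -/
def W (L : DirectionLabelling Γ root) : ℕ → UDCell Γ n → UDCell Γ n → Prop
  | 0, c, c' => c.dim = 0 ∧ L.IsPrincipalReduction c c'
  | i + 1, c, c' => c.dim = i + 1 ∧ L.IsPrincipalReduction c c' ∧ ¬ ∃ b, L.W i b c

/-- A cell is redundant if it is in the domain of `W`. -/
def IsRedundant (L : DirectionLabelling Γ root) (c : UDCell Γ n) : Prop :=
  ∃ i c', L.W i c c'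

/-- A cell is collapsible if it is in the image of `W`. -/
def IsCollapsible (L : DirectionLabelling Γ root) (c : UDCell Γ n) : Prop :=
  ∃ i b, L.W i b c

/-- A cell is critical if it is neither redundant nor collapsible. -/
def IsCritical (L : DirectionLabelling Γ root) (c : UDCell Γ n) : Prop :=
  ¬ L.IsRedundant c ∧ ¬ L.IsCollapsible c

/-- The subcomplex `(UDⁿΓ)'ₖ`: the `k`-skeleton of `UDⁿΓ` with the redundant `k`-cells removed,
as the union of its open cells. -/
def skeletonPrime (L : DirectionLabelling Γ root) (n k : ℕ) : Set (UDConf Γ n) :=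
  {q | ∃ c : UDCell Γ n, q ∈ c.openCell ∧ c.dim ≤ k ∧ ¬ (c.dim = k ∧ L.IsRedundant c)}

end DirectionLabelling

/-- The space `X` strong deformation retracts onto the subset `A`: the identity is homotopic,
through maps fixing `A` pointwise, to a map with image in `A`. -/
def StrongDeformationRetractsOnto (X : Type*) [TopologicalSpace X] (A : Set X) : Prop :=
  ∃ r : C(X, X), (∀ x, r x ∈ A) ∧ (ContinuousMap.id X).HomotopicRel r A

/-! The discrete vector field is a toggle. Call `v` active in a cell when it is an unblocked vertex,
or when the edge `e(v)` belongs to the cell and no smaller sibling of `v` (a vertex with the same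
parent) does. Exchanging the least active `v` with `e(v)` leaves it the least active one
(`isMinActive_iff`), so this exchange pairs off all cells that have an active vertex. The recursive
definition of `W` yields exactly this pairing (`W_iff`), hence a critical cell has no active vertex.

Consequently each edge `e(v)` of a critical cell comes with a sibling of `v` in the cell. The parent
of `v` then has two children, so it is essential, as the root has degree 1. Disjoint edges have
distinct parents, which bounds the dimension by the number of essential vertices. The edges and
their siblings are distinct members of the cell, so twice the dimension is at most `n`.

For the retraction, pairs are collapsed one at a time. Among the remaining cells a lexicographically
maximal one for (dimension, depth, rank) is the upper cell of a pair whose lower cell is a free face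
(`exists_free_face`). This replaces an acyclicity argument along gradient paths.

Geometrically, adding up the barycentric coordinates of the points embeds `UDConf Γ n` in `V → ℝ`,
because in a tree the sum determines the cell (`eq_of_mem_interior`). Each closed cell becomes a
convex polytope. A collapse is a central projection from a point beyond the free face, and the
straight segments to the projected points provide the homotopy. -/

set_option linter.unusedSectionVars false

/-! ### Parents and geodesics in a rooted tree. -/

namespace SimpleGraph

variable {V : Type*} {Γ : SimpleGraph V} {root u v w : V}

/-- Geodesics from the root to the two neighbours extend to paths ending at `v`; uniqueness of paths
in a tree makes their penultimate vertices equal. -/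
theorem IsTree.eq_of_adj_of_dist_lt (hΓ : Γ.IsTree) (hu : Γ.Adj v u) (hw : Γ.Adj v w)
    (hdu : Γ.dist root u < Γ.dist root v) (hdw : Γ.dist root w < Γ.dist root v) : u = w := by
  classical
  have key : ∀ x, Γ.Adj v x → Γ.dist root x < Γ.dist root v →
      ∃ p : Γ.Walk root v, p.IsPath ∧ p.penultimate = x := by
    intro x hx hd
    obtain ⟨p, hp, hl⟩ := hΓ.connected.exists_path_of_dist root x
    refine ⟨p.concat hx.symm, ?_, by simp⟩
    have h1 : Γ.dist root v ≤ Γ.dist root x + 1 := by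
      simpa [hl] using Γ.dist_le (p.concat hx.symm)
    apply Walk.isPath_of_length_eq_dist
    rw [Walk.length_concat]; omega
  obtain ⟨p, hp, rfl⟩ := key u hu hdu
  obtain ⟨q, hq, rfl⟩ := key w hw hdw
  rw [(hΓ.existsUnique_path root v).unique hp hq]

theorem IsTree.exists_adj_dist_eq_add_one (hΓ : Γ.IsTree) (h : u ≠ v) :
    ∃ w, Γ.Adj u w ∧ Γ.dist u v = Γ.dist w v + 1 := by
  obtain ⟨p, hp⟩ := hΓ.connected.exists_walk_length_eq_dist u v
  cases p with
  | nil => exact absurd rfl h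
  | @cons _ w _ hadj q =>
    refine ⟨w, hadj, ?_⟩
    have h1 := Γ.dist_le q
    have h2 := hΓ.connected.dist_triangle (u := u) (v := w) (w := v)
    have h3 := SimpleGraph.dist_eq_one_iff_adj.2 hadj
    rw [Walk.length_cons] at hp
    omega

theorem IsTree.nextVertex_spec (hΓ : Γ.IsTree) (h : u ≠ v) :
    Γ.Adj u (nextVertex Γ u v) ∧ Γ.dist u v = Γ.dist (nextVertex Γ u v) v + 1 := by
  have := hΓ.exists_adj_dist_eq_add_one h
  rw [nextVertex, dif_pos this]
  exact this.choose_spec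

/-- The neighbour of `v` which is closest to the root; the root is its own parent. -/
noncomputable abbrev parent (Γ : SimpleGraph V) (root v : V) : V := nextVertex Γ v root

theorem IsTree.adj_parent (hΓ : Γ.IsTree) (h : v ≠ root) : Γ.Adj v (Γ.parent root v) :=
  (hΓ.nextVertex_spec h).1

theorem IsTree.dist_parent (hΓ : Γ.IsTree) (h : v ≠ root) :
    Γ.dist root v = Γ.dist root (Γ.parent root v) + 1 := by
  rw [dist_comm, (hΓ.nextVertex_spec h).2, dist_comm]

theorem IsTree.parent_ne (hΓ : Γ.IsTree) (h : v ≠ root) : Γ.parent root v ≠ v :=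
  (hΓ.adj_parent h).ne'

theorem IsTree.eq_parent_of_dist_lt (hΓ : Γ.IsTree) (hadj : Γ.Adj v w)
    (h : Γ.dist root w < Γ.dist root v) : v ≠ root ∧ w = Γ.parent root v := by
  have hv : v ≠ root := by rintro rfl; simp at h
  refine ⟨hv, hΓ.eq_of_adj_of_dist_lt hadj (hΓ.adj_parent hv) h ?_⟩
  rw [hΓ.dist_parent hv]; omega

theorem IsTree.adj_cases (hΓ : Γ.IsTree) (root : V) (hadj : Γ.Adj v w) :
    (v ≠ root ∧ w = Γ.parent root v) ∨ (w ≠ root ∧ v = Γ.parent root w) := by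
  rcases hΓ.dist_eq_dist_add_one_of_adj root hadj with h | h
  · exact .inl (hΓ.eq_parent_of_dist_lt hadj (by omega))
  · exact .inr (hΓ.eq_parent_of_dist_lt hadj.symm (by omega))

theorem IsTree.left_mem_geodesic (u v : V) : u ∈ geodesic Γ u v := by
  simp [geodesic]

theorem IsTree.mem_geodesic_parent_iff (hΓ : Γ.IsTree) (hu : u ≠ root) (hw : w ≠ u) :
    w ∈ geodesic Γ root u ↔ w ∈ geodesic Γ root (Γ.parent root u) := by
  have hp := hΓ.dist_parent hu
  have h1 := SimpleGraph.dist_eq_one_iff_adj.2 (hΓ.adj_parent hu)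
  simp only [geodesic, Set.mem_ofPred_eq]
  constructor
  · intro h
    obtain ⟨x, hx, hd⟩ := hΓ.exists_adj_dist_eq_add_one hw.symm
    have t := hΓ.connected.dist_triangle (u := root) (v := w) (w := x)
    rw [dist_comm (u := w) (v := x)] at t
    rw [dist_comm (u := w) (v := u)] at h
    obtain rfl := (hΓ.eq_parent_of_dist_lt (root := root) hx (by omega)).2
    rw [dist_comm (u := w)]
    omega
  · intro h
    have t := hΓ.connected.dist_triangle (u := root) (v := w) (w := u)
    have t' := hΓ.connected.dist_triangle (u := w) (v := Γ.parent root u) (w := u)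
    rw [dist_comm (u := Γ.parent root u) (v := u)] at t'
    omega

theorem IsTree.nextVertex_of_mem_geodesic (hΓ : Γ.IsTree) (hw : w ∈ geodesic Γ root u)
    (h : w ≠ u) : nextVertex Γ w u ∈ geodesic Γ root u ∧ nextVertex Γ w u ≠ root ∧
      Γ.parent root (nextVertex Γ w u) = w := by
  obtain ⟨hadj, hd⟩ := hΓ.nextVertex_spec h
  set x := nextVertex Γ w u
  have h1 := SimpleGraph.dist_eq_one_iff_adj.2 hadj
  have t := hΓ.connected.dist_triangle (u := root) (v := w) (w := x)
  have t' := hΓ.connected.dist_triangle (u := root) (v := x) (w := u)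
  simp only [geodesic, Set.mem_ofPred_eq] at hw ⊢
  obtain ⟨h2, h3⟩ := hΓ.eq_parent_of_dist_lt (root := root) hadj.symm (by omega)
  exact ⟨by omega, h2, h3.symm⟩

end SimpleGraph

/-! ### The vertex order as the lexicographic order of addresses. -/

namespace DirectionLabelling

open SimpleGraph

variable {V : Type*} [Fintype V] [DecidableEq V] {Γ : SimpleGraph V} [DecidableRel Γ.Adj]
  {root u v w m : V}

/-- The labels of the last `k` directions on the way from the root to a vertex. -/
noncomputable def lastLabels (L : DirectionLabelling Γ root) : ℕ → V → List ℕ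
  | 0, _ => []
  | k + 1, v => L.lastLabels k (Γ.parent root v) ++ [L.label (Γ.parent root v) v]

/-- The labels of the directions along the geodesic from the root to a vertex. -/
noncomputable def address (L : DirectionLabelling Γ root) (v : V) : List ℕ :=
  L.lastLabels (Γ.dist root v) v

theorem address_root (L : DirectionLabelling Γ root) : L.address root = [] := by
  simp [address, lastLabels]

theorem address_of_ne (L : DirectionLabelling Γ root) (hΓ : Γ.IsTree) (hv : v ≠ root) :
    L.address v = L.address (Γ.parent root v) ++ [L.label (Γ.parent root v) v] := by
  rw [address, hΓ.dist_parent hv, lastLabels, address]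

theorem address_prefix (L : DirectionLabelling Γ root) (hΓ : Γ.IsTree)
    (h : w ∈ geodesic Γ root u) : L.address w <+: L.address u := by
  induction hd : Γ.dist root u generalizing u with
  | zero =>
    have : u = root := by
      have := (hΓ.connected.dist_eq_zero_iff).1 hd; exact this.symm
    subst this
    simp only [geodesic, Set.mem_ofPred_eq, dist_self] at h
    have : w = u := hΓ.connected.dist_eq_zero_iff.1 (by omega)
    rw [this]
  | succ d ih =>
    by_cases hw : w = u
    · rw [hw]
    have hu : u ≠ root := by rintro rfl; simp at hd
    rw [hΓ.mem_geodesic_parent_iff hu hw] at h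
    rw [L.address_of_ne hΓ hu]
    exact (ih h (by have := hΓ.dist_parent hu; omega)).trans (List.prefix_append _ _)

theorem address_eq_append (L : DirectionLabelling Γ root) (hΓ : Γ.IsTree)
    (h : w ∈ geodesic Γ root u) (hne : w ≠ u) :
    ∃ l, L.address u = L.address w ++ L.g w u :: l := by
  obtain ⟨h1, h2, h3⟩ := hΓ.nextVertex_of_mem_geodesic h hne
  obtain ⟨l, hl⟩ := L.address_prefix hΓ h1
  refine ⟨l, ?_⟩
  rw [← hl, L.address_of_ne hΓ h2, h3, g, if_neg hne]
  simp

theorem address_injective (L : DirectionLabelling Γ root) (hΓ : Γ.IsTree) :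
    Function.Injective L.address := by
  intro u v h
  have hr : ∀ v, v ≠ root → L.address v ≠ [] := fun v hv => by simp [L.address_of_ne hΓ hv]
  induction hd : Γ.dist root u generalizing u v with
  | zero =>
    obtain rfl := hΓ.connected.dist_eq_zero_iff.1 hd
    rw [address_root] at h
    by_contra hv
    exact hr v (Ne.symm hv) h.symm
  | succ d ih =>
    have hu : u ≠ root := by rintro rfl; simp at hd
    have hv : v ≠ root := by rintro rfl; rw [address_root] at h; exact hr u hu h
    rw [L.address_of_ne hΓ hu, L.address_of_ne hΓ hv] at h
    obtain ⟨h1, h2⟩ := List.append_inj' h rfl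
    have hp := ih h1 (by have := hΓ.dist_parent hu; omega)
    rw [← hp] at h2
    exact L.label_injective _ _ _ (hΓ.adj_parent hu).symm (hp ▸ (hΓ.adj_parent hv).symm)
      (by simpa using h2)

theorem exists_isMeet (L : DirectionLabelling Γ root) (u v : V) : ∃ m, L.IsMeet m u v := by
  classical
  obtain ⟨m, hm, hmax⟩ := (Finset.univ.filter fun w =>
    w ∈ geodesic Γ root u ∩ geodesic Γ root v).exists_max_image (Γ.dist root)
    ⟨root, by simp [IsTree.left_mem_geodesic]⟩
  exact ⟨m, by simpa using hm, fun w hw => hmax w (by simpa using hw)⟩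

theorem IsMeet.symm {L : DirectionLabelling Γ root} (h : L.IsMeet m u v) : L.IsMeet m v u :=
  ⟨h.1.symm, fun w hw => h.2 w hw.symm⟩

/-- Equal labels would give a common next vertex on both geodesics, farther from the root than the
meet. -/
theorem IsMeet.g_ne {L : DirectionLabelling Γ root} (hΓ : Γ.IsTree) (h : L.IsMeet m u v)
    (hu : m ≠ u) (hv : m ≠ v) : L.g m u ≠ L.g m v := by
  intro he
  rw [g, g, if_neg hu, if_neg hv] at he
  have h1 := hΓ.nextVertex_of_mem_geodesic h.1.1 hu
  have h2 := hΓ.nextVertex_of_mem_geodesic h.1.2 hv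
  have := L.label_injective _ _ _ (hΓ.nextVertex_spec hu).1 (hΓ.nextVertex_spec hv).1 he
  have h3 := h.2 _ ⟨h1.1, this ▸ h2.1⟩
  have h4 := hΓ.dist_parent h1.2.1
  rw [h1.2.2] at h4
  omega

theorem vertexLE_total (L : DirectionLabelling Γ root) (hΓ : Γ.IsTree) (u v : V) :
    L.vertexLE u v ∨ L.vertexLE v u := by
  obtain ⟨m, hm⟩ := L.exists_isMeet u v
  by_cases hu : m = u
  · exact .inl ⟨m, hm, .inl hu⟩
  by_cases hv : m = v
  · exact .inr ⟨m, hm.symm, .inl hv⟩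
  rcases lt_or_gt_of_ne (hm.g_ne hΓ hu hv) with h | h
  · exact .inl ⟨m, hm, .inr ⟨hu, h⟩⟩
  · exact .inr ⟨m, hm.symm, .inr ⟨hv, h⟩⟩

/-- The address of the meet is a common prefix of both addresses. Either it is all of the address of
`u`, or the next labels `g(m, u) < g(m, v)` decide the lexicographic comparison. -/
theorem vertexLE.address_le {L : DirectionLabelling Γ root} (hΓ : Γ.IsTree)
    (h : L.vertexLE u v) : L.address u ≤ L.address v := by
  obtain ⟨m, hm, rfl | ⟨hu, hlt⟩⟩ := h
  · exact not_lt.1 (L.address_prefix hΓ hm.1.2).le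
  · have hv : m ≠ v := by rintro rfl; simp [g] at hlt
    obtain ⟨l, hl⟩ := L.address_eq_append hΓ hm.1.1 hu
    obtain ⟨l', hl'⟩ := L.address_eq_append hΓ hm.1.2 hv
    rw [hl, hl']
    exact le_of_lt (List.append_left_lt (List.Lex.rel hlt))

theorem vertexLE_iff_address_le (L : DirectionLabelling Γ root) (hΓ : Γ.IsTree) :
    L.vertexLE u v ↔ L.address u ≤ L.address v := by
  refine ⟨fun h => h.address_le hΓ, fun h => ?_⟩
  rcases L.vertexLE_total hΓ u v with h' | h'
  · exact h'
  · obtain rfl := L.address_injective hΓ (le_antisymm h (h'.address_le hΓ))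
    exact h'

/-- The position of a vertex in the order on the vertices. -/
noncomputable def rank (L : DirectionLabelling Γ root) (v : V) : ℕ :=
  (Finset.univ.filter fun u => L.address u < L.address v).card

theorem rank_le_of_address_le (L : DirectionLabelling Γ root)
    (h : L.address u ≤ L.address v) : L.rank u ≤ L.rank v :=
  Finset.card_le_card (Finset.monotone_filter_right _ fun _ _ hw => lt_of_lt_of_le hw h)

theorem rank_lt_of_address_lt (L : DirectionLabelling Γ root)
    (h : L.address u < L.address v) : L.rank u < L.rank v := by
  refine Finset.card_lt_card ⟨Finset.monotone_filter_right _ fun _ _ hw => lt_trans hw h, ?_⟩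
  intro hs
  simpa using hs (Finset.mem_filter.2 ⟨Finset.mem_univ u, h⟩)

theorem vertexLE_iff_rank_le (L : DirectionLabelling Γ root) (hΓ : Γ.IsTree) :
    L.vertexLE u v ↔ L.rank u ≤ L.rank v := by
  rw [L.vertexLE_iff_address_le hΓ]
  refine ⟨L.rank_le_of_address_le, fun h => ?_⟩
  by_contra hlt
  exact absurd (L.rank_lt_of_address_lt (not_le.1 hlt)) (not_lt.2 h)

theorem rank_injective (L : DirectionLabelling Γ root) (hΓ : Γ.IsTree) :
    Function.Injective L.rank := by
  intro u v h
  apply L.address_injective hΓ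
  exact le_antisymm ((L.vertexLE_iff_address_le hΓ).1 ((L.vertexLE_iff_rank_le hΓ).2 h.le))
    ((L.vertexLE_iff_address_le hΓ).1 ((L.vertexLE_iff_rank_le hΓ).2 h.ge))

end DirectionLabelling

/-! ### Replacing one member of a cell. -/

namespace UDCell

variable {V : Type*} [DecidableEq V] {Γ : SimpleGraph V} {n : ℕ} {s t : Finset V} {v : V}

theorem nonempty_of_isGraphCell (h : IsGraphCell Γ s) : s.Nonempty := by
  rcases h with ⟨v, rfl⟩ | ⟨u, w, -, rfl⟩ <;> simp

theorem eq_of_mem_of_mem (c : UDCell Γ n) (hs : s ∈ c.cells) (ht : t ∈ c.cells) (hvs : v ∈ s)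
    (hvt : v ∈ t) : s = t := by
  by_contra h
  exact Finset.disjoint_left.1 (c.disjoint s hs t ht h) hvs hvt

/-- The cell obtained by replacing one member of a cell. -/
def replace (c : UDCell Γ n) (s t : Finset V) (hs : s ∈ c.cells) (ht : IsGraphCell Γ t)
    (hd : ∀ s' ∈ c.cells, s' ≠ s → Disjoint t s') : UDCell Γ n where
  cells := insert t (c.cells.erase s)
  isGraphCell := by
    intro s' hs'
    rcases Finset.mem_insert.1 hs' with rfl | h
    · exact ht
    · exact c.isGraphCell _ (Finset.mem_of_mem_erase h)
  disjoint := by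
    intro a ha b hb hab
    rw [Finset.mem_insert, Finset.mem_erase] at ha hb
    rcases ha with rfl | ⟨ha, ha'⟩ <;> rcases hb with rfl | ⟨hb, hb'⟩
    · exact absurd rfl hab
    · exact hd b hb' hb
    · exact (hd a ha' ha).symm
    · exact c.disjoint a ha' b hb' hab
  card_cells := by
    rw [Finset.card_insert_of_notMem, Finset.card_erase_add_one hs, c.card_cells]
    intro h
    obtain ⟨v, hv⟩ := nonempty_of_isGraphCell ht
    rw [Finset.mem_erase] at h
    exact Finset.disjoint_left.1 (hd t h.2 h.1) hv hv

/-- Both cells have `n` members, so `t` is not among the members kept. With different choices of `f`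
this computes the change of dimension, depth and rank; the additive form avoids subtraction in `ℕ`.
-/
theorem sum_replace (c c' : UDCell Γ n) (hs : s ∈ c.cells)
    (h : c'.cells = insert t (c.cells.erase s)) (f : Finset V → ℕ) :
    ∑ a ∈ c'.cells, f a + f s = ∑ a ∈ c.cells, f a + f t := by
  have hcard := c'.card_cells
  rw [h] at hcard
  have hnot : t ∉ c.cells.erase s := by
    intro ht
    have h1 := Finset.card_erase_add_one hs
    rw [Finset.insert_eq_of_mem ht] at hcard
    have := c.card_cells
    omega
  rw [h, Finset.sum_insert hnot, ← Finset.sum_erase_add _ _ hs]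
  ring

theorem dim_eq_sum (c : UDCell Γ n) : c.dim = ∑ s ∈ c.cells, if s.card = 2 then 1 else 0 := by
  rw [dim, Finset.card_filter]

instance [Fintype V] : Finite (UDCell Γ n) :=
  Finite.of_injective UDCell.cells fun _ _ h => UDCell.ext h

/-- `c` is a face of `c'`. -/
def IsFace (c c' : UDCell Γ n) : Prop := ∀ t ∈ c'.cells, ∃ s ∈ c.cells, s ⊆ t

end UDCell

/-! ### The matching by least active vertices, and its agreement with `W`. -/

namespace DirectionLabelling

open SimpleGraph

variable {V : Type*} [Fintype V] [DecidableEq V] {Γ : SimpleGraph V} [DecidableRel Γ.Adj]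
  {root u v w m : V} {n : ℕ} {c c' : UDCell Γ n} {s : Finset V}

theorem mem_rootEdge (L : DirectionLabelling Γ root) :
    w ∈ L.rootEdge v ↔ w = v ∨ w = Γ.parent root v := by
  simp [rootEdge, SimpleGraph.parent]

theorem self_mem_rootEdge (L : DirectionLabelling Γ root) : v ∈ L.rootEdge v :=
  L.mem_rootEdge.2 (.inl rfl)

theorem parent_mem_rootEdge (L : DirectionLabelling Γ root) : Γ.parent root v ∈ L.rootEdge v :=
  L.mem_rootEdge.2 (.inr rfl)

theorem card_rootEdge (L : DirectionLabelling Γ root) (hΓ : Γ.IsTree) (hv : v ≠ root) :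
    (L.rootEdge v).card = 2 :=
  Finset.card_pair (hΓ.parent_ne hv).symm

theorem isGraphCell_rootEdge (L : DirectionLabelling Γ root) (hΓ : Γ.IsTree) (hv : v ≠ root) :
    IsGraphCell Γ (L.rootEdge v) :=
  .inr ⟨_, _, hΓ.adj_parent hv, rfl⟩

theorem rootEdge_ne_singleton (L : DirectionLabelling Γ root) (hΓ : Γ.IsTree) (hv : v ≠ root) :
    L.rootEdge v ≠ {u} := by
  intro h
  have := L.card_rootEdge hΓ hv
  simp [h] at this

theorem rootEdge_inj (L : DirectionLabelling Γ root) (hΓ : Γ.IsTree) (hu : u ≠ root)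
    (hv : v ≠ root) (h : L.rootEdge u = L.rootEdge v) : u = v := by
  have h1 := L.mem_rootEdge.1 (h ▸ L.self_mem_rootEdge : u ∈ L.rootEdge v)
  have h2 := L.mem_rootEdge.1 (h ▸ L.self_mem_rootEdge : v ∈ L.rootEdge u)
  rcases h1 with h1 | h1
  · exact h1
  rcases h2 with h2 | h2
  · exact h2.symm
  have d1 := hΓ.dist_parent hu
  have d2 := hΓ.dist_parent hv
  rw [← h1] at d2
  rw [← h2] at d1
  omega

theorem cases_of_isGraphCell (L : DirectionLabelling Γ root) (hΓ : Γ.IsTree)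
    (h : IsGraphCell Γ s) : (∃ v, s = {v}) ∨ ∃ v, v ≠ root ∧ s = L.rootEdge v := by
  rcases h with h | ⟨u, w, hadj, rfl⟩
  · exact .inl h
  · right
    rcases hΓ.adj_cases root hadj with ⟨hu, rfl⟩ | ⟨hw, rfl⟩
    · exact ⟨u, hu, rfl⟩
    · exact ⟨w, hw, Finset.pair_comm _ _⟩

/-- By the default value of `nextVertex` the root is its own parent, so it formally counts as a
sibling of its child. In that case `e(v)` contains the root, and `{root}` cannot be another member.
-/
theorem ne_root_of_mem_of_parent_eq (L : DirectionLabelling Γ root) (hΓ : Γ.IsTree)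
    (hv : v ≠ root) (hu : {u} ∈ c.cells) (he : L.rootEdge v ∈ c.cells)
    (hp : Γ.parent root u = Γ.parent root v) : u ≠ root := by
  rintro rfl
  have : Γ.parent u u = u := by
    rw [SimpleGraph.parent, nextVertex, dif_neg]
    rintro ⟨w, -, h⟩
    simp at h
  rw [this] at hp
  refine L.rootEdge_ne_singleton hΓ hv (c.eq_of_mem_of_mem he hu ?_ (Finset.mem_singleton_self u))
  exact L.mem_rootEdge.2 (.inr hp)

/-- A vertex or an edge of `c` which a matching of cells may use: the vertex `v` if it is unblocked,
and the edge from `v` to its parent if no smaller sibling of `v` is a member of `c`. -/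
def Active (L : DirectionLabelling Γ root) (c : UDCell Γ n) (v : V) : Prop :=
  L.Unblocked c v ∨ (v ≠ root ∧ L.rootEdge v ∈ c.cells ∧
    ∀ u, {u} ∈ c.cells → Γ.parent root u = Γ.parent root v → L.rank v < L.rank u)

/-- The vertex `v` is the smallest active one. -/
def IsMinActive (L : DirectionLabelling Γ root) (c : UDCell Γ n) (v : V) : Prop :=
  L.Active c v ∧ ∀ u, L.Active c u → L.rank v ≤ L.rank u

theorem exists_isMinActive (L : DirectionLabelling Γ root) (h : L.Active c v) :
    ∃ m, L.IsMinActive c m := by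
  classical
  obtain ⟨m, hm, hmin⟩ := (Finset.univ.filter (L.Active c)).exists_min_image L.rank
    ⟨v, by simpa using h⟩
  exact ⟨m, by simpa using hm, fun u hu => hmin u (by simpa using hu)⟩

theorem IsMinActive.unique {L : DirectionLabelling Γ root} (hΓ : Γ.IsTree)
    (h : L.IsMinActive c u) (h' : L.IsMinActive c v) : u = v :=
  L.rank_injective hΓ (le_antisymm (h.2 _ h'.1) (h'.2 _ h.1))

theorem exists_isElementaryReduction (L : DirectionLabelling Γ root) (hΓ : Γ.IsTree)
    (h : L.Unblocked c v) : ∃ c', L.IsElementaryReduction c v c' :=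
  ⟨c.replace {v} (L.rootEdge v) h.1 (L.isGraphCell_rootEdge hΓ h.2.1) h.2.2, h, rfl⟩

namespace IsElementaryReduction

variable {L : DirectionLabelling Γ root}

theorem mem_iff (h : L.IsElementaryReduction c v c') :
    s ∈ c'.cells ↔ s = L.rootEdge v ∨ s ≠ {v} ∧ s ∈ c.cells := by
  rw [h.2, Finset.mem_insert, Finset.mem_erase]

theorem rootEdge_mem (h : L.IsElementaryReduction c v c') : L.rootEdge v ∈ c'.cells :=
  h.mem_iff.2 (.inl rfl)

theorem rootEdge_notMem (h : L.IsElementaryReduction c v c') (hΓ : Γ.IsTree) :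
    L.rootEdge v ∉ c.cells := fun hmem =>
  L.rootEdge_ne_singleton hΓ h.1.2.1
    (c.eq_of_mem_of_mem hmem h.1.1 L.self_mem_rootEdge (Finset.mem_singleton_self v))

theorem singleton_notMem (h : L.IsElementaryReduction c v c') (hΓ : Γ.IsTree) :
    {v} ∉ c'.cells := fun hmem =>
  L.rootEdge_ne_singleton hΓ h.1.2.1
    (c'.eq_of_mem_of_mem h.rootEdge_mem hmem L.self_mem_rootEdge (Finset.mem_singleton_self v))

theorem mem_iff' (h : L.IsElementaryReduction c v c') (hΓ : Γ.IsTree) :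
    s ∈ c.cells ↔ s = {v} ∨ s ≠ L.rootEdge v ∧ s ∈ c'.cells := by
  rw [h.mem_iff]
  by_cases h1 : s = {v}
  · simp [h1, h.1.1]
  by_cases h2 : s = L.rootEdge v
  · simp [h2, h.rootEdge_notMem hΓ, L.rootEdge_ne_singleton hΓ h.1.2.1]
  · simp [h1, h2]

theorem unique (h : L.IsElementaryReduction c v c') {d : UDCell Γ n}
    (h' : L.IsElementaryReduction c v d) : c' = d :=
  UDCell.ext (h.2.trans h'.2.symm)

theorem unique_left (h : L.IsElementaryReduction c v c') (hΓ : Γ.IsTree) {d : UDCell Γ n}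
    (h' : L.IsElementaryReduction d v c') : c = d := by
  apply UDCell.ext
  ext s
  rw [h.mem_iff' hΓ, h'.mem_iff' hΓ]

theorem sum_eq (h : L.IsElementaryReduction c v c') (f : Finset V → ℕ) :
    ∑ a ∈ c'.cells, f a + f {v} = ∑ a ∈ c.cells, f a + f (L.rootEdge v) :=
  c.sum_replace c' h.1.1 h.2 f

theorem dim_eq (h : L.IsElementaryReduction c v c') (hΓ : Γ.IsTree) : c'.dim = c.dim + 1 := by
  have := h.sum_eq fun s => if s.card = 2 then 1 else 0
  rw [UDCell.dim_eq_sum, UDCell.dim_eq_sum]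
  simpa [L.card_rootEdge hΓ h.1.2.1] using this

theorem isFace (h : L.IsElementaryReduction c v c') : c.IsFace c' := by
  intro t ht
  rcases h.mem_iff.1 ht with rfl | ht
  · exact ⟨_, h.1.1, by simpa using L.self_mem_rootEdge⟩
  · exact ⟨t, ht.2, subset_rfl⟩

/-- The members of `c` lie inside those of `c'`, so they block no more. -/
theorem unblocked_left (h : L.IsElementaryReduction c v c') (hΓ : Γ.IsTree)
    (hu : L.Unblocked c' u) : L.Unblocked c u := by
  have hne : ({u} : Finset V) ≠ L.rootEdge v := (L.rootEdge_ne_singleton hΓ h.1.2.1).symm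
  have huc : {u} ∈ c.cells := (h.mem_iff.1 hu.1).resolve_left hne |>.2
  refine ⟨huc, hu.2.1, fun s hs hsu => ?_⟩
  rcases (h.mem_iff' hΓ).1 hs with rfl | hs'
  · exact (hu.2.2 _ h.rootEdge_mem hne.symm).mono_right (by simpa using L.self_mem_rootEdge)
  · exact hu.2.2 s hs'.2 hsu

/-- Compared with `{v}`, the edge `e(v)` newly covers only the parent of `v`, which belonged to no
member of `c`. Only siblings of `v` can become blocked. -/
theorem unblocked_cases (h : L.IsElementaryReduction c v c')
    (hu : L.Unblocked c u) : u = v ∨ L.Unblocked c' u ∨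
      ({u} ∈ c'.cells ∧ Γ.parent root u = Γ.parent root v) := by
  by_cases huv : u = v
  · exact .inl huv
  right
  have hu' : {u} ∈ c'.cells := h.mem_iff.2 (.inr ⟨by simpa using huv, hu.1⟩)
  by_cases hp : Γ.parent root u = Γ.parent root v
  · exact .inr ⟨hu', hp⟩
  refine .inl ⟨hu', hu.2.1, fun s hs hsu => ?_⟩
  rcases h.mem_iff.1 hs with rfl | hs'
  · rw [Finset.disjoint_left]
    intro x hx hx'
    rcases L.mem_rootEdge.1 hx with rfl | rfl
    · exact hsu (c'.eq_of_mem_of_mem hs hu' hx' (Finset.mem_singleton_self x))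
    rcases L.mem_rootEdge.1 hx' with h1 | h1
    · refine Finset.disjoint_left.1 (hu.2.2 {v} h.1.1 ?_) hx (by simp [h1])
      simpa using Ne.symm huv
    · exact hp h1
  · exact hu.2.2 s hs'.2 hsu

/-- As `v` is unblocked in `c`, no member of `c` contains the common parent, so nothing obstructs
`e(u)`. -/
theorem unblocked_of_parent_eq (h : L.IsElementaryReduction c v c') (hΓ : Γ.IsTree)
    (hu : {u} ∈ c'.cells) (hp : Γ.parent root u = Γ.parent root v) : L.Unblocked c u := by
  have hne : ({u} : Finset V) ≠ L.rootEdge v := (L.rootEdge_ne_singleton hΓ h.1.2.1).symm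
  have huc := (h.mem_iff.1 hu).resolve_left hne
  have huv : u ≠ v := fun h => huc.1 (by rw [h])
  refine ⟨huc.2, L.ne_root_of_mem_of_parent_eq hΓ h.1.2.1 hu h.rootEdge_mem hp, fun s hs hsu => ?_⟩
  rw [Finset.disjoint_left]
  intro x hx hx'
  rcases L.mem_rootEdge.1 hx with rfl | rfl
  · exact hsu (c.eq_of_mem_of_mem hs huc.2 hx' (Finset.mem_singleton_self x))
  rw [hp] at hx'
  rcases (h.mem_iff' hΓ).1 hs with rfl | hs'
  · exact hΓ.parent_ne h.1.2.1 (by simpa using hx')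
  · exact hs'.1 (c'.eq_of_mem_of_mem hs'.2 h.rootEdge_mem hx' L.parent_mem_rootEdge)

/-- The exchange affects only siblings of `v`: they are unblocked before it and blocked after it.
Minimality on the left says that they are larger than `v`; on the right this is the sibling
condition in the activity of `e(v)`. -/
theorem isMinActive_iff (h : L.IsElementaryReduction c v c') (hΓ : Γ.IsTree) :
    L.IsMinActive c v ↔ L.IsMinActive c' v := by
  constructor
  · intro hm
    refine ⟨.inr ⟨h.1.2.1, h.rootEdge_mem, fun u hu hp => ?_⟩, fun u hu => ?_⟩
    · refine lt_of_le_of_ne (hm.2 u (.inl (h.unblocked_of_parent_eq hΓ hu hp))) fun hr => ?_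
      obtain rfl := L.rank_injective hΓ hr
      exact h.singleton_notMem hΓ hu
    · rcases hu with hu | ⟨hur, hu, hres⟩
      · exact hm.2 u (.inl (h.unblocked_left hΓ hu))
      rcases h.mem_iff.1 hu with he | hu'
      · rw [L.rootEdge_inj hΓ hur h.1.2.1 he]
      by_contra hlt
      -- Restoring `{v}` does not spoil the activity of `e(u)`, because `u` is assumed smaller than
      -- `v`.
      refine hlt (hm.2 u (.inr ⟨hur, hu'.2, fun x hx hp => ?_⟩))
      by_cases hxv : x = v
      · rw [hxv]; exact not_le.1 hlt
      · exact hres x (h.mem_iff.2 (.inr ⟨by simpa using hxv, hx⟩)) hp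
  · intro hm
    refine ⟨.inl h.1, fun u hu => ?_⟩
    rcases hu with hu | ⟨hur, hu, hres⟩
    · rcases h.unblocked_cases hu with rfl | hu' | ⟨hu', hp⟩
      · exact le_rfl
      · exact hm.2 u (.inl hu')
      · rcases hm.1 with hv | hv
        · exact absurd hv.1 (h.singleton_notMem hΓ)
        · exact (hv.2.2 u hu' hp).le
    · refine hm.2 u (.inr ⟨hur, ?_, fun x hx hp => ?_⟩)
      · exact h.mem_iff.2 (.inr ⟨L.rootEdge_ne_singleton hΓ hur, hu⟩)
      · exact hres x ((h.mem_iff.1 hx).resolve_left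
          (L.rootEdge_ne_singleton hΓ h.1.2.1).symm).2 hp

end IsElementaryReduction

theorem exists_isElementaryReduction_to (L : DirectionLabelling Γ root) (hΓ : Γ.IsTree)
    (hv : v ≠ root) (h : L.rootEdge v ∈ c'.cells) : ∃ c, L.IsElementaryReduction c v c' := by
  have hd : ∀ s ∈ c'.cells, s ≠ L.rootEdge v → Disjoint (L.rootEdge v) s := fun s hs hne =>
    c'.disjoint _ h _ hs hne.symm
  have hv' : ({v} : Finset V) ∉ c'.cells := fun hmem =>
    L.rootEdge_ne_singleton hΓ hv
      (c'.eq_of_mem_of_mem h hmem L.self_mem_rootEdge (Finset.mem_singleton_self v))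
  refine ⟨c'.replace (L.rootEdge v) {v} h (.inl ⟨v, rfl⟩) fun s hs hne =>
    (hd s hs hne).mono_left (by simpa using L.self_mem_rootEdge), ⟨?_, hv, ?_⟩, ?_⟩
  · simp [UDCell.replace]
  · intro s hs hne
    simp only [UDCell.replace, Finset.mem_insert, Finset.mem_erase] at hs
    have := hs.resolve_left hne
    exact hd s this.2 this.1
  · ext s
    simp only [UDCell.replace, Finset.mem_insert, Finset.mem_erase]
    by_cases h1 : s = L.rootEdge v
    · simp [h1, h]
    · by_cases h2 : s = {v}
      · simp [h2, hv', (L.rootEdge_ne_singleton hΓ hv).symm]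
      · simp [h1, h2]

/-- The cells `c` and `c'` are matched by the discrete vector field: `c'` arises from `c` by
replacing the smallest active vertex `v` by its edge. -/
def Matched (L : DirectionLabelling Γ root) (c : UDCell Γ n) (v : V) (c' : UDCell Γ n) : Prop :=
  L.IsElementaryReduction c v c' ∧ L.IsMinActive c v

theorem Active.exists_matched {L : DirectionLabelling Γ root} (hΓ : Γ.IsTree)
    (h : L.Active c u) : (∃ v c', L.Matched c v c') ∨ ∃ v b, L.Matched b v c := by
  obtain ⟨m, hm⟩ := L.exists_isMinActive h
  rcases hm.1 with hu | hu
  · obtain ⟨c', hc'⟩ := L.exists_isElementaryReduction hΓ hu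
    exact .inl ⟨m, c', hc', hm⟩
  · obtain ⟨b, hb⟩ := L.exists_isElementaryReduction_to hΓ hu.1 hu.2.1
    exact .inr ⟨m, b, hb, (hb.isMinActive_iff hΓ).2 hm⟩

theorem Matched.isMinActive_right {L : DirectionLabelling Γ root} (hΓ : Γ.IsTree)
    (h : L.Matched c v c') : L.IsMinActive c' v :=
  (h.1.isMinActive_iff hΓ).1 h.2

theorem Matched.not_matched {L : DirectionLabelling Γ root} (hΓ : Γ.IsTree)
    (h : L.Matched c v c') {d : UDCell Γ n} : ¬ L.Matched c' u d := by
  intro h'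
  obtain rfl := h'.2.unique hΓ (h.isMinActive_right hΓ)
  exact h.1.singleton_notMem hΓ h'.1.1.1

theorem Matched.left_unique {L : DirectionLabelling Γ root} (hΓ : Γ.IsTree)
    (h : L.Matched c v c') {d : UDCell Γ n} (h' : L.Matched d u c') : c = d := by
  obtain rfl := (h'.isMinActive_right hΓ).unique hΓ (h.isMinActive_right hΓ)
  exact h.1.unique_left hΓ h'.1

/-- If the least active vertex is an unblocked one, it is also the least unblocked vertex and gives
the principal reduction. If it is an edge, the cell is already a value of `W` one dimension lower.
In dimension 0 there are no edges, so active means unblocked. -/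
theorem W_iff (L : DirectionLabelling Γ root) (hΓ : Γ.IsTree) (i : ℕ) (c c' : UDCell Γ n) :
    L.W i c c' ↔ c.dim = i ∧ ∃ v, L.Matched c v c' := by
  induction i generalizing c c' with
  | zero =>
    refine and_congr_right fun hd => exists_congr fun v => and_congr_right fun h => ?_
    have hact : ∀ u, L.Active c u → L.Unblocked c u := by
      rintro u (hu | hu)
      · exact hu
      · rw [UDCell.dim, Finset.card_eq_zero, Finset.filter_eq_empty_iff] at hd
        exact absurd (L.card_rootEdge hΓ hu.1) (hd hu.2.1)
    exact ⟨fun hm => ⟨.inl h.1, fun u hu => (L.vertexLE_iff_rank_le hΓ).1 (hm u (hact u hu))⟩,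
      fun hm u hu => (L.vertexLE_iff_rank_le hΓ).2 (hm.2 u (.inl hu))⟩
  | succ i ih =>
    refine and_congr_right fun hd => ?_
    simp only [ih]
    constructor
    · rintro ⟨⟨v, h, hmin⟩, hno⟩
      rcases (show L.Active c v from .inl h.1).exists_matched hΓ with ⟨u, d, hu⟩ | ⟨u, b, hu⟩
      · have : u = v := L.rank_injective hΓ (le_antisymm (hu.2.2 v (.inl h.1))
          ((L.vertexLE_iff_rank_le hΓ).1 (hmin u hu.1.1)))
        subst this
        exact ⟨u, h, hu.2⟩
      · refine absurd ⟨b, ?_, u, hu⟩ hno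
        have := hu.1.dim_eq hΓ
        omega
    · rintro ⟨v, h⟩
      refine ⟨⟨v, h.1, fun u hu => (L.vertexLE_iff_rank_le hΓ).2 (h.2.2 u (.inl hu))⟩, ?_⟩
      rintro ⟨b, -, u, hb⟩
      exact hb.not_matched hΓ h

theorem isRedundant_iff (L : DirectionLabelling Γ root) (hΓ : Γ.IsTree) :
    L.IsRedundant c ↔ ∃ v c', L.Matched c v c' := by
  simp only [IsRedundant, L.W_iff hΓ]
  exact ⟨fun ⟨_, c', _, v, h⟩ => ⟨v, c', h⟩, fun ⟨v, c', h⟩ => ⟨_, c', rfl, v, h⟩⟩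

theorem isCollapsible_iff (L : DirectionLabelling Γ root) (hΓ : Γ.IsTree) :
    L.IsCollapsible c ↔ ∃ v b, L.Matched b v c := by
  simp only [IsCollapsible, L.W_iff hΓ]
  exact ⟨fun ⟨_, c', _, v, h⟩ => ⟨v, c', h⟩, fun ⟨v, c', h⟩ => ⟨_, c', rfl, v, h⟩⟩

theorem IsCritical.not_active {L : DirectionLabelling Γ root} (hΓ : Γ.IsTree)
    (h : L.IsCritical c) : ¬ L.Active c v := fun ha => by
  rw [IsCritical, L.isRedundant_iff hΓ, L.isCollapsible_iff hΓ] at h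
  rcases ha.exists_matched hΓ with h' | h'
  · exact h.1 h'
  · exact h.2 h'

end DirectionLabelling

/-! ### Dimension of critical cells, faces, and free faces. -/

namespace DirectionLabelling

open SimpleGraph

variable {V : Type*} [Fintype V] [DecidableEq V] {Γ : SimpleGraph V} [DecidableRel Γ.Adj]
  {root u v w m : V} {n : ℕ} {c c' : UDCell Γ n} {s : Finset V}

open Classical in
/-- The vertices other than the root whose edge towards the root belongs to the cell `c`. -/
noncomputable def edgeTops (L : DirectionLabelling Γ root) (c : UDCell Γ n) : Finset V :=
  Finset.univ.filter fun v => v ≠ root ∧ L.rootEdge v ∈ c.cells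

theorem mem_edgeTops (L : DirectionLabelling Γ root) :
    v ∈ L.edgeTops c ↔ v ≠ root ∧ L.rootEdge v ∈ c.cells := by
  simp [edgeTops]

theorem rootEdge_injOn_edgeTops (L : DirectionLabelling Γ root) (hΓ : Γ.IsTree) :
    Set.InjOn L.rootEdge (L.edgeTops c : Set V) := fun _ hu _ hv h =>
  L.rootEdge_inj hΓ (L.mem_edgeTops.1 hu).1 (L.mem_edgeTops.1 hv).1 h

theorem parent_injOn_edgeTops (L : DirectionLabelling Γ root) (hΓ : Γ.IsTree) :
    Set.InjOn (Γ.parent root) (L.edgeTops c : Set V) := by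
  intro u hu v hv h
  refine L.rootEdge_injOn_edgeTops hΓ hu hv (c.eq_of_mem_of_mem (L.mem_edgeTops.1 hu).2
    (L.mem_edgeTops.1 hv).2 L.parent_mem_rootEdge ?_)
  rw [h]
  exact L.parent_mem_rootEdge

theorem dim_eq_card_edgeTops (L : DirectionLabelling Γ root) (hΓ : Γ.IsTree)
    (c : UDCell Γ n) : c.dim = (L.edgeTops c).card := by
  rw [← Finset.card_image_of_injOn (L.rootEdge_injOn_edgeTops hΓ), UDCell.dim]
  congr 1
  ext s
  simp only [Finset.mem_filter, Finset.mem_image, L.mem_edgeTops]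
  constructor
  · rintro ⟨hs, hcard⟩
    rcases L.cases_of_isGraphCell hΓ (c.isGraphCell s hs) with ⟨v, rfl⟩ | ⟨v, hv, rfl⟩
    · simp at hcard
    · exact ⟨v, ⟨hv, hs⟩, rfl⟩
  · rintro ⟨v, ⟨hv, hs⟩, rfl⟩
    exact ⟨hs, L.card_rootEdge hΓ hv⟩

/-- In a critical cell, every edge blocks a smaller sibling of its end away from the root. -/
theorem IsCritical.exists_sibling {L : DirectionLabelling Γ root} (hΓ : Γ.IsTree)
    (h : L.IsCritical c) (hv : v ∈ L.edgeTops c) :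
    ∃ u, {u} ∈ c.cells ∧ u ≠ root ∧ u ≠ v ∧ Γ.parent root u = Γ.parent root v := by
  rw [L.mem_edgeTops] at hv
  have hna := h.not_active hΓ (v := v)
  simp only [Active, not_or, not_and, not_forall] at hna
  obtain ⟨u, hu, hp, -⟩ := hna.2 hv.1 hv.2
  refine ⟨u, hu, L.ne_root_of_mem_of_parent_eq hΓ hv.1 hu hv.2 hp, ?_, hp⟩
  rintro rfl
  exact L.rootEdge_ne_singleton hΓ hv.1
    (c.eq_of_mem_of_mem hv.2 hu L.self_mem_rootEdge (Finset.mem_singleton_self u))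

/-- A common parent other than the root has the two children and its own parent as neighbours. The
root, being of degree 1, has no two children. -/
theorem three_le_degree_parent (hΓ : Γ.IsTree) (hroot : Γ.degree root = 1) (hu : u ≠ root)
    (hv : v ≠ root) (huv : u ≠ v) (hp : Γ.parent root u = Γ.parent root v) :
    3 ≤ Γ.degree (Γ.parent root v) := by
  have hu' : Γ.Adj (Γ.parent root v) u := hp ▸ (hΓ.adj_parent hu).symm
  have hv' := (hΓ.adj_parent hv).symm
  have hd := hΓ.dist_parent hv
  have hd' := hΓ.dist_parent hu
  set w := Γ.parent root v
  by_cases hw : w = root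
  · rw [← hw] at hroot
    obtain ⟨x, hx⟩ := Finset.card_eq_one.1 hroot
    have h1 : u ∈ Γ.neighborFinset w := by simpa using hu'
    have h2 : v ∈ Γ.neighborFinset w := by simpa using hv'
    rw [hx, Finset.mem_singleton] at h1 h2
    exact absurd (h1.trans h2.symm) huv
  have hd'' := hΓ.dist_parent hw
  have h3 : ({u, v, Γ.parent root w} : Finset V).card = 3 := by
    rw [hp] at hd'
    refine Finset.card_eq_three.2 ⟨_, _, _, huv, ?_, ?_, rfl⟩ <;> intro he
    · rw [← he] at hd''; omega
    · rw [← he] at hd''; omega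
  rw [← h3, ← Γ.card_neighborFinset_eq_degree]
  refine Finset.card_le_card fun x hx => ?_
  simp only [Finset.mem_insert, Finset.mem_singleton] at hx
  rw [mem_neighborFinset]
  rcases hx with rfl | rfl | rfl
  · exact hu'
  · exact hv'
  · exact hΓ.adj_parent hw

theorem IsCritical.dim_le_card_essential {L : DirectionLabelling Γ root} (hΓ : Γ.IsTree)
    (hroot : Γ.degree root = 1) (h : L.IsCritical c) :
    c.dim ≤ (Finset.univ.filter fun v : V => 3 ≤ Γ.degree v).card := by
  rw [L.dim_eq_card_edgeTops hΓ]
  refine Finset.card_le_card_of_injOn (Γ.parent root) (fun v hv => ?_)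
    (L.parent_injOn_edgeTops hΓ)
  obtain ⟨u, -, hu, huv, hp⟩ := h.exists_sibling hΓ hv
  simpa using three_le_degree_parent hΓ hroot hu (L.mem_edgeTops.1 hv).1 huv hp

theorem IsCritical.two_mul_dim_le {L : DirectionLabelling Γ root} (hΓ : Γ.IsTree)
    (h : L.IsCritical c) : 2 * c.dim ≤ n := by
  have hex : ∀ v, ∃ u, v ∈ L.edgeTops c → {u} ∈ c.cells ∧
      Γ.parent root u = Γ.parent root v := fun v => by
    by_cases hv : v ∈ L.edgeTops c
    · obtain ⟨u, hu, -, -, hp⟩ := h.exists_sibling hΓ hv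
      exact ⟨u, fun _ => ⟨hu, hp⟩⟩
    · exact ⟨v, fun h => absurd h hv⟩
  choose f hf using hex
  have hinj : Set.InjOn (fun v => ({f v} : Finset V)) (L.edgeTops c : Set V) := by
    intro u hu v hv he
    refine L.parent_injOn_edgeTops hΓ hu hv ?_
    rw [← (hf u hu).2, ← (hf v hv).2, Finset.singleton_injective he]
  have hdisj : Disjoint ((L.edgeTops c).image L.rootEdge)
      ((L.edgeTops c).image fun v => ({f v} : Finset V)) := by
    rw [Finset.disjoint_left]
    intro s hs hs'
    obtain ⟨v, hv, rfl⟩ := Finset.mem_image.1 hs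
    obtain ⟨u, -, hu⟩ := Finset.mem_image.1 hs'
    exact L.rootEdge_ne_singleton hΓ (L.mem_edgeTops.1 hv).1 hu.symm
  have hcard := Finset.card_union_of_disjoint hdisj
  rw [Finset.card_image_of_injOn (L.rootEdge_injOn_edgeTops hΓ), Finset.card_image_of_injOn hinj,
    ← L.dim_eq_card_edgeTops hΓ] at hcard
  rw [two_mul, ← hcard]
  refine (Finset.card_le_card (Finset.union_subset ?_ ?_)).trans_eq c.card_cells
  · intro s hs
    obtain ⟨v, hv, rfl⟩ := Finset.mem_image.1 hs
    exact (L.mem_edgeTops.1 hv).2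
  · intro s hs
    obtain ⟨v, hv, rfl⟩ := Finset.mem_image.1 hs
    exact (hf v hv).1

/-! ### Faces -/

/-- A proper face lies in a facet, obtained by replacing an edge by one of its ends. -/
theorem exists_facet (L : DirectionLabelling Γ root) (hΓ : Γ.IsTree) (h : c.IsFace c')
    (hne : c ≠ c') : ∃ (d : UDCell Γ n) (v x : V), v ≠ root ∧ L.rootEdge v ∈ c'.cells ∧
      (x = v ∨ x = Γ.parent root v) ∧ d.cells = insert {x} (c'.cells.erase (L.rootEdge v)) ∧
      c.IsFace d := by
  -- Both cells have `n` members, so different cells differ by a member of `c'` missing from `c`; it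
  -- must be an edge that properly contains a vertex of `c`.
  obtain ⟨t, ht, htc⟩ : ∃ t ∈ c'.cells, t ∉ c.cells := by
    by_contra! hall
    refine hne (UDCell.ext (Finset.eq_of_subset_of_card_le hall ?_).symm)
    rw [c.card_cells, c'.card_cells]
  obtain ⟨s, hs, hst⟩ := h t ht
  obtain ⟨y, hy⟩ := UDCell.nonempty_of_isGraphCell (c.isGraphCell s hs)
  rcases L.cases_of_isGraphCell hΓ (c'.isGraphCell t ht) with ⟨v, rfl⟩ | ⟨v, hv, rfl⟩
  · refine absurd ?_ htc
    rwa [← (Finset.Nonempty.subset_singleton_iff ⟨y, hy⟩).1 hst]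
  have hcard : s.card < 2 := by
    rw [← L.card_rootEdge hΓ hv]
    exact Finset.card_lt_card (lt_of_le_of_ne hst fun h => htc (h ▸ hs))
  obtain ⟨x, rfl⟩ := Finset.card_eq_one.1
    (le_antisymm (Nat.lt_succ_iff.1 hcard) (Finset.card_pos.2 ⟨y, hy⟩))
  have hx : x ∈ L.rootEdge v := by simpa using hst
  refine ⟨c'.replace (L.rootEdge v) {x} ht (.inl ⟨x, rfl⟩) fun s' hs' hne' =>
    (c'.disjoint _ ht _ hs' hne'.symm).mono_left hst, v, x, hv, ht, L.mem_rootEdge.1 hx, rfl, ?_⟩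
  intro t' ht'
  simp only [UDCell.replace, Finset.mem_insert, Finset.mem_erase] at ht'
  rcases ht' with rfl | ht'
  · exact ⟨_, hs, subset_rfl⟩
  · exact h t' ht'.2

theorem dim_add_one_of_facet (L : DirectionLabelling Γ root) (hΓ : Γ.IsTree) (hv : v ≠ root)
    (he : L.rootEdge v ∈ c'.cells)
    (h : c.cells = insert {u} (c'.cells.erase (L.rootEdge v))) : c.dim + 1 = c'.dim := by
  have := c'.sum_replace c he h fun s => if s.card = 2 then 1 else 0
  rw [UDCell.dim_eq_sum, UDCell.dim_eq_sum]
  simpa [L.card_rootEdge hΓ hv] using this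

theorem dim_le_of_isFace (L : DirectionLabelling Γ root) (hΓ : Γ.IsTree) (h : c.IsFace c') :
    c.dim ≤ c'.dim ∧ (c'.dim ≤ c.dim → c = c') := by
  induction hd : c'.dim generalizing c' with
  | zero =>
    by_cases hne : c = c'
    · subst hne; exact ⟨hd.le, fun _ => rfl⟩
    · obtain ⟨d, v, x, hv, he, -, hd', -⟩ := L.exists_facet hΓ h hne
      have := L.dim_add_one_of_facet hΓ hv he hd'
      omega
  | succ k ih =>
    by_cases hne : c = c'
    · subst hne; exact ⟨hd.le, fun _ => rfl⟩
    · obtain ⟨d, v, x, hv, he, -, hd', hf⟩ := L.exists_facet hΓ h hne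
      have := L.dim_add_one_of_facet hΓ hv he hd'
      have := (ih hf (by omega)).1
      exact ⟨by omega, fun _ => by omega⟩

/-- The sum of the depths of the members of a cell, an edge having the depth of its end away from
the root. -/
noncomputable def depthSum (_L : DirectionLabelling Γ root) (c : UDCell Γ n) : ℕ :=
  ∑ s ∈ c.cells, s.sup (Γ.dist root)

open Classical in
/-- The sum of the ranks of the ends away from the root of the edges of a cell. -/
noncomputable def rankSum (L : DirectionLabelling Γ root) (c : UDCell Γ n) : ℕ :=
  ∑ s ∈ c.cells, ∑ v ∈ Finset.univ.filter (fun v => v ≠ root ∧ s = L.rootEdge v), L.rank v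

theorem sup_dist_rootEdge (L : DirectionLabelling Γ root) (hΓ : Γ.IsTree) (hv : v ≠ root) :
    (L.rootEdge v).sup (Γ.dist root) = Γ.dist root v := by
  have := hΓ.dist_parent hv
  simp only [rootEdge, Finset.sup_insert, Finset.sup_singleton]
  exact max_eq_left (by simp only [SimpleGraph.parent] at this; omega)

theorem depthSum_eq_of_isElementaryReduction {L : DirectionLabelling Γ root} (hΓ : Γ.IsTree)
    (h : L.IsElementaryReduction c v c') : L.depthSum c' = L.depthSum c := by
  have := h.sum_eq fun s => s.sup (Γ.dist root)
  simpa [depthSum, L.sup_dist_rootEdge hΓ h.1.2.1] using this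

theorem rankSum_eq_of_isElementaryReduction {L : DirectionLabelling Γ root} (hΓ : Γ.IsTree)
    (h : L.IsElementaryReduction c v c') : L.rankSum c' = L.rankSum c + L.rank v := by
  classical
  have := h.sum_eq fun s =>
    ∑ v ∈ Finset.univ.filter (fun v => v ≠ root ∧ s = L.rootEdge v), L.rank v
  have h1 : Finset.univ.filter (fun u => u ≠ root ∧ {v} = L.rootEdge u) = ∅ :=
    Finset.filter_eq_empty_iff.2 fun u _ hu => L.rootEdge_ne_singleton hΓ hu.1 hu.2.symm
  have h2 : Finset.univ.filter (fun u => u ≠ root ∧ L.rootEdge v = L.rootEdge u) = {v} := by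
    ext u
    simp only [Finset.mem_filter, Finset.mem_univ, true_and, Finset.mem_singleton]
    constructor
    · rintro ⟨hu, he⟩
      exact (L.rootEdge_inj hΓ h.1.2.1 hu he).symm
    · rintro rfl
      exact ⟨h.1.2.1, rfl⟩
  rw [h1, h2, Finset.sum_empty, Finset.sum_singleton, add_zero] at this
  exact this

theorem depthSum_lt_of_facet (L : DirectionLabelling Γ root) (hΓ : Γ.IsTree) (hv : v ≠ root)
    (he : L.rootEdge v ∈ c'.cells)
    (h : c.cells = insert {Γ.parent root v} (c'.cells.erase (L.rootEdge v))) :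
    L.depthSum c < L.depthSum c' := by
  have h1 := c'.sum_replace c he h fun s => s.sup (Γ.dist root)
  have h2 := hΓ.dist_parent hv
  simp only [L.sup_dist_rootEdge hΓ hv, Finset.sup_singleton] at h1
  simp only [depthSum]
  omega

/-- The acyclicity of the discrete vector field, in the form of the existence of a free face. -/
theorem exists_free_face (L : DirectionLabelling Γ root) (hΓ : Γ.IsTree) {k : ℕ}
    (hcrit : ∀ c : UDCell Γ n, L.IsCritical c → c.dim ≤ k) (K : Set (UDCell Γ n))
    (hred : ∀ c c' v, L.Matched c v c' → c ∈ K → k ≤ c.dim → c' ∈ K)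
    (hlow : ∀ c c', c.IsFace c' → c' ∈ K → c ∈ K)
    (hex : ∃ c ∈ K, ¬ (c.dim ≤ k ∧ ¬ (c.dim = k ∧ L.IsRedundant c))) :
    ∃ c v c', L.Matched c v c' ∧ c ∈ K ∧ c' ∈ K ∧ k ≤ c.dim ∧
      (∀ d ∈ K, c.IsFace d → d = c ∨ d = c') ∧ ∀ d ∈ K, c'.IsFace d → d = c' := by
  -- Maximal dimension leaves `τ` without proper cofaces in `K`. The depth will exclude other
  -- cofaces of `σ` that lose an edge for its end nearer the root, and the rank those that lose it
  -- for the far end.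
  obtain ⟨τ, hτ, hmax⟩ := K.toFinite.exists_maximalFor
    (fun c => toLex (c.dim, toLex (L.depthSum c, L.rankSum c))) K (let ⟨c, hc, _⟩ := hex; ⟨c, hc⟩)
  have hmax' : ∀ c ∈ K, toLex (c.dim, toLex (L.depthSum c, L.rankSum c)) ≤
      toLex (τ.dim, toLex (L.depthSum τ, L.rankSum τ)) := fun c hc =>
    (le_total _ _).elim id fun h => hmax hc h
  simp only [Prod.Lex.toLex_le_toLex] at hmax'
  have hdim : ∀ c ∈ K, c.dim ≤ τ.dim := fun c hc => by
    rcases hmax' c hc with h | h <;> omega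
  -- A cell still to be removed has dimension above `k`, or is a redundant `k`-cell whose partner in
  -- `K` has dimension `k + 1`.
  have hk : k < τ.dim := by
    obtain ⟨c, hc, hck⟩ := hex
    by_cases h : c.dim ≤ k
    · have h2 : c.dim = k ∧ L.IsRedundant c := by tauto
      obtain ⟨v, c', hm⟩ := (L.isRedundant_iff hΓ).1 h2.2
      have := hdim c' (hred _ _ _ hm hc h2.1.ge)
      have := hm.1.dim_eq hΓ
      omega
    · have := hdim c hc
      omega
  have hnr : ¬ L.IsRedundant τ := by
    rw [L.isRedundant_iff hΓ]
    rintro ⟨v, c', hm⟩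
    have := hdim c' (hred _ _ _ hm hτ hk.le)
    have := hm.1.dim_eq hΓ
    omega
  have hcol : L.IsCollapsible τ := by
    by_contra hnc
    have := hcrit τ ⟨hnr, hnc⟩
    omega
  obtain ⟨v, σ, hm⟩ := (L.isCollapsible_iff hΓ).1 hcol
  have hd := hm.1.dim_eq hΓ
  refine ⟨σ, v, τ, hm, hlow _ _ hm.1.isFace hτ, hτ, by omega, fun ρ hρ hf => ?_, fun ρ hρ hf =>
    ((L.dim_le_of_isFace hΓ hf).2 (hdim ρ hρ)).symm⟩
  by_cases hne : σ = ρ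
  · exact .inl hne.symm
  right
  obtain ⟨d, u, x, hu, he, hx, hdc, hfd⟩ := L.exists_facet hΓ hf hne
  have hdd := L.dim_add_one_of_facet hΓ hu he hdc
  obtain rfl := (L.dim_le_of_isFace hΓ hfd).2 (by have := hdim ρ hρ; omega)
  have hds := depthSum_eq_of_isElementaryReduction hΓ hm.1
  have hrs := rankSum_eq_of_isElementaryReduction hΓ hm.1
  have hmρ := hmax' ρ hρ
  rcases hx with rfl | rfl
  -- Here `x` is unblocked in `σ`. Depths agree, so maximality of `τ` gives `rank x ≤ rank v`; the
  -- reverse holds since `v` is least active.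
  · obtain ⟨d', hd'⟩ := L.exists_isElementaryReduction_to hΓ hu he
    have : d' = σ := by
      apply UDCell.ext
      rw [hdc]
      ext s
      rw [hd'.mem_iff' hΓ]
      simp
    subst this
    have hds' := depthSum_eq_of_isElementaryReduction hΓ hd'
    have hrs' := rankSum_eq_of_isElementaryReduction hΓ hd'
    have hle : L.rank x ≤ L.rank v := by
      rcases hmρ with h | ⟨-, h | ⟨-, h⟩⟩ <;> omega
    have hge := hm.2.2 x (.inl hd'.1)
    obtain rfl := L.rank_injective hΓ (le_antisymm hle hge)
    exact hd'.unique hm.1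
  -- Here `ρ` is deeper than `σ`, whereas `τ` has the same depth as `σ`.
  · have := L.depthSum_lt_of_facet hΓ hu he hdc
    rcases hmρ with h | ⟨-, h | ⟨h, -⟩⟩ <;> omega

end DirectionLabelling

/-! ### Straight-line homotopies lifted through an embedding. -/

theorem ContinuousMap.exists_homotopicRel_of_segment_subset {X E : Type*} [TopologicalSpace X]
    [NormedAddCommGroup E] [NormedSpace ℝ E] {Φ : X → E} (hΦ : Topology.IsEmbedding Φ)
    {A : Set X} {S : Set E} (R : C(X, X)) (hR : ∀ x, Φ (R x) ∈ S) {r : E → E}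
    (hr : ContinuousOn r S) (hseg : ∀ y ∈ S, segment ℝ y (r y) ⊆ Set.range Φ)
    (hA : ∀ x ∈ A, r (Φ (R x)) = Φ (R x)) :
    ∃ R' : C(X, X), (∀ x, Φ (R' x) = r (Φ (R x))) ∧ R.HomotopicRel R' A := by
  have hex : ∀ p : unitInterval × X, ∃ z,
      Φ z = AffineMap.lineMap (Φ (R p.2)) (r (Φ (R p.2))) (p.1 : ℝ) := fun p =>
    hseg _ (hR p.2) (by rw [segment_eq_image_lineMap]; exact ⟨p.1, p.1.2, rfl⟩)
  choose H hH using hex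
  have hrc : Continuous fun x => r (Φ (R x)) :=
    hr.comp_continuous (hΦ.continuous.comp R.continuous) hR
  have hHc : Continuous H := by
    rw [hΦ.continuous_iff]
    have hc : Continuous fun p : unitInterval × X =>
        AffineMap.lineMap (Φ (R p.2)) (r (Φ (R p.2))) (p.1 : ℝ) := by
      simp only [AffineMap.lineMap_apply_module]
      have h1 : Continuous fun p : unitInterval × X => Φ (R p.2) :=
        hΦ.continuous.comp (R.continuous.comp continuous_snd)
      have h2 : Continuous fun p : unitInterval × X => r (Φ (R p.2)) := hrc.comp continuous_snd
      have h3 : Continuous fun p : unitInterval × X => (p.1 : ℝ) :=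
        continuous_subtype_val.comp continuous_fst
      exact ((continuous_const.sub h3).smul h1).add (h3.smul h2)
    exact hc.congr fun p => (hH p).symm
  refine ⟨⟨fun x => H (1, x), hHc.comp (by fun_prop)⟩, fun x => by simp [hH], ⟨?_⟩⟩
  refine ⟨⟨⟨H, hHc⟩, fun x => hΦ.injective (by simp [hH]), fun x => rfl⟩, fun t x hx => ?_⟩
  exact hΦ.injective (by simp [hH, hA x hx])

/-! ### Linear coordinates on configurations and their cells. -/

section Configurations

variable {V : Type*} [Fintype V] [DecidableEq V] {Γ : SimpleGraph V} {n : ℕ} {v : V}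

theorem mem_carrier {x : V → ℝ} : v ∈ carrier x ↔ x v ≠ 0 := by simp [carrier]

theorem IsGraphCell.subset {s t : Finset V} (ht : IsGraphCell Γ t) (hst : s ⊆ t)
    (hs : s.Nonempty) : IsGraphCell Γ s := by
  rcases ht with ⟨v, rfl⟩ | ⟨u, w, hadj, rfl⟩
  · exact .inl ⟨v, (Finset.Nonempty.subset_singleton_iff hs).1 hst⟩
  · by_cases hu : u ∈ s
    · by_cases hw : w ∈ s
      · refine .inr ⟨u, w, hadj, hst.antisymm ?_⟩
        simp [Finset.insert_subset_iff, hu, hw]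
      · refine .inl ⟨u, (Finset.Nonempty.subset_singleton_iff hs).1 fun x hx => ?_⟩
        have := hst hx
        simp only [Finset.mem_insert, Finset.mem_singleton] at this ⊢
        exact this.resolve_right fun h => hw (h ▸ hx)
    · refine .inl ⟨w, (Finset.Nonempty.subset_singleton_iff hs).1 fun x hx => ?_⟩
      have := hst hx
      simp only [Finset.mem_insert, Finset.mem_singleton] at this ⊢
      exact this.resolve_left fun h => hu (h ▸ hx)

theorem disjoint_closedCellOf_iff (x y : Realization Γ) :
    Disjoint (closedCellOf x) (closedCellOf y) ↔ Disjoint (carrier x.1) (carrier y.1) := by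
  constructor
  · intro h
    rw [Finset.disjoint_left]
    intro v hx hy
    have hc : carrier (Pi.single v 1 : V → ℝ) = {v} := by
      ext u
      simp [mem_carrier, Pi.single_apply]
    have hp : ∀ z : Realization Γ, v ∈ carrier z.1 →
        (⟨Pi.single v 1, single_mem_stdSimplex ℝ v, .inl ⟨v, hc⟩⟩ : Realization Γ) ∈
          closedCellOf z := fun z hz => by
      change carrier _ ⊆ _
      simpa [hc] using hz
    exact Set.disjoint_left.1 h (hp x hx) (hp y hy)
  · intro h
    rw [Set.disjoint_left]
    intro z hx hy
    obtain ⟨v, hv⟩ := UDCell.nonempty_of_isGraphCell z.2.2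
    exact Finset.disjoint_left.1 h (hx hv) (hy hv)

namespace DConf

theorem disjoint_carrier (x : DConf Γ n) {i j : Fin n} (h : i ≠ j) :
    Disjoint (carrier (x.1 i).1) (carrier (x.1 j).1) :=
  (disjoint_closedCellOf_iff _ _).1 (x.2 i j h)

theorem carrier_injective (x : DConf Γ n) :
    Function.Injective fun i => carrier (x.1 i).1 := by
  intro i j h
  by_contra hij
  obtain ⟨v, hv⟩ := UDCell.nonempty_of_isGraphCell (x.1 i).2.2
  have h' : carrier (x.1 i).1 = carrier (x.1 j).1 := h
  exact Finset.disjoint_left.1 (x.disjoint_carrier hij) hv (h' ▸ hv)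

/-- The cell in whose interior a configuration lies. -/
noncomputable def cell (x : DConf Γ n) : UDCell Γ n where
  cells := Finset.univ.image fun i => carrier (x.1 i).1
  isGraphCell := by
    intro s hs
    obtain ⟨i, -, rfl⟩ := Finset.mem_image.1 hs
    exact (x.1 i).2.2
  disjoint := by
    intro s hs t ht h
    obtain ⟨i, -, rfl⟩ := Finset.mem_image.1 hs
    obtain ⟨j, -, rfl⟩ := Finset.mem_image.1 ht
    exact x.disjoint_carrier fun hij => h (by rw [hij])
  card_cells := by
    rw [Finset.card_image_of_injective _ x.carrier_injective, Finset.card_univ, Fintype.card_fin]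

/-- The sum of the barycentric coordinates of the points of a configuration. -/
noncomputable def weight (x : DConf Γ n) : V → ℝ := fun v => ∑ i, (x.1 i).1 v

theorem weight_eq (x : DConf Γ n) {i : Fin n} (h : v ∈ carrier (x.1 i).1) :
    x.weight v = (x.1 i).1 v := by
  refine Finset.sum_eq_single i (fun j _ hji => ?_) (by simp)
  by_contra hne
  exact Finset.disjoint_left.1 (x.disjoint_carrier hji) (mem_carrier.2 hne) h

end DConf

namespace UDCell

/-- The coordinates of the configurations in the closed cell of `c`. -/
def polytope (c : UDCell Γ n) : Set (V → ℝ) :=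
  {y | (∀ v, 0 ≤ y v) ∧ (∀ s ∈ c.cells, ∑ v ∈ s, y v = 1) ∧
    ∀ v, (∀ s ∈ c.cells, v ∉ s) → y v = 0}

/-- The coordinates of the configurations in the open cell of `c`. -/
def interior (c : UDCell Γ n) : Set (V → ℝ) :=
  {y | y ∈ c.polytope ∧ ∀ s ∈ c.cells, ∀ v ∈ s, y v ≠ 0}

variable {c : UDCell Γ n} {y : V → ℝ}

theorem exists_mem_of_ne_zero (h : y ∈ c.polytope) (hv : y v ≠ 0) : ∃ s ∈ c.cells, v ∈ s := by
  by_contra! hno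
  exact hv (h.2.2 v hno)

theorem isClosed_polytope (c : UDCell Γ n) : IsClosed c.polytope := by
  have h : c.polytope = (⋂ v, {y : V → ℝ | 0 ≤ y v}) ∩
      ((⋂ s ∈ c.cells, {y : V → ℝ | ∑ v ∈ s, y v = 1}) ∩
        ⋂ v, ⋂ (_ : ∀ s ∈ c.cells, v ∉ s), {y : V → ℝ | y v = 0}) := by
    ext y
    simp [polytope]
  rw [h]
  refine (isClosed_iInter fun v => ?_).inter ((isClosed_iInter fun s => isClosed_iInter fun _ =>
    ?_).inter (isClosed_iInter fun v => isClosed_iInter fun _ => ?_))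
  · exact isClosed_le (by fun_prop) (by fun_prop)
  · exact isClosed_eq (by fun_prop) (by fun_prop)
  · exact isClosed_eq (by fun_prop) (by fun_prop)

theorem convex_polytope (c : UDCell Γ n) : Convex ℝ c.polytope := by
  intro x hx y hy a b ha hb hab
  refine ⟨fun v => ?_, fun s hs => ?_, fun v hv => ?_⟩
  · have := hx.1 v
    have := hy.1 v
    simp only [Pi.add_apply, Pi.smul_apply, smul_eq_mul]
    positivity
  · simp only [Pi.add_apply, Pi.smul_apply, smul_eq_mul, Finset.sum_add_distrib,
      ← Finset.mul_sum, hx.2.1 s hs, hy.2.1 s hs]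
    linarith
  · simp [hx.2.2 v hv, hy.2.2 v hv]

/-- Every point of a closed cell lies in the open cell of a face. -/
theorem exists_isFace_of_mem_polytope (h : y ∈ c.polytope) :
    ∃ d : UDCell Γ n, d.IsFace c ∧ y ∈ d.interior := by
  -- Each member carries total weight 1, so it meets the carrier of `y`; these intersections are the
  -- members of the face.
  have hne : ∀ t ∈ c.cells, (t ∩ carrier y).Nonempty := by
    intro t ht
    by_contra hemp
    rw [Finset.not_nonempty_iff_eq_empty] at hemp
    have hz : ∑ v ∈ t, y v = 0 := Finset.sum_eq_zero fun v hv => by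
      by_contra hyv
      exact Finset.notMem_empty v (hemp ▸ Finset.mem_inter.2 ⟨hv, mem_carrier.2 hyv⟩)
    rw [h.2.1 t ht] at hz
    exact one_ne_zero hz
  have hinj : Set.InjOn (fun t => t ∩ carrier y) (c.cells : Set (Finset V)) := by
    intro t ht t' ht' he
    obtain ⟨v, hv⟩ := hne t ht
    have he' : t ∩ carrier y = t' ∩ carrier y := he
    exact c.eq_of_mem_of_mem ht ht' (Finset.mem_inter.1 hv).1
      (Finset.mem_inter.1 (he' ▸ hv)).1
  refine ⟨⟨c.cells.image fun t => t ∩ carrier y, ?_, ?_, ?_⟩, ?_, ⟨h.1, ?_, ?_⟩, ?_⟩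
  · intro s hs
    obtain ⟨t, ht, rfl⟩ := Finset.mem_image.1 hs
    exact (c.isGraphCell t ht).subset Finset.inter_subset_left (hne t ht)
  · intro s hs s' hs' hss
    obtain ⟨t, ht, rfl⟩ := Finset.mem_image.1 hs
    obtain ⟨t', ht', rfl⟩ := Finset.mem_image.1 hs'
    exact (c.disjoint t ht t' ht' fun he => hss (by rw [he])).mono Finset.inter_subset_left
      Finset.inter_subset_left
  · rw [Finset.card_image_of_injOn hinj, c.card_cells]
  · intro t ht
    exact ⟨_, Finset.mem_image_of_mem _ ht, Finset.inter_subset_left⟩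
  · intro s hs
    obtain ⟨t, ht, rfl⟩ := Finset.mem_image.1 hs
    rw [← h.2.1 t ht]
    refine Finset.sum_subset Finset.inter_subset_left fun v hv hv' => ?_
    by_contra hyv
    exact hv' (Finset.mem_inter.2 ⟨hv, mem_carrier.2 hyv⟩)
  · intro v hv
    by_contra hyv
    obtain ⟨t, ht, hvt⟩ := exists_mem_of_ne_zero h hyv
    exact hv _ (Finset.mem_image_of_mem _ ht) (Finset.mem_inter.2 ⟨hvt, mem_carrier.2 hyv⟩)
  · intro s hs v hv
    obtain ⟨t, ht, rfl⟩ := Finset.mem_image.1 hs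
    exact mem_carrier.1 (Finset.mem_inter.1 hv).2

/-- The union of the open cells in a set of cells. -/
def realize (K : Set (UDCell Γ n)) : Set (V → ℝ) := ⋃ c ∈ K, c.interior

theorem mem_realize {K : Set (UDCell Γ n)} : y ∈ realize K ↔ ∃ c ∈ K, y ∈ c.interior := by
  simp [realize]

theorem polytope_subset_realize {K : Set (UDCell Γ n)}
    (hK : ∀ c c', c.IsFace c' → c' ∈ K → c ∈ K) (hc : c ∈ K) : c.polytope ⊆ realize K := by
  intro y hy
  obtain ⟨d, hd, hyd⟩ := exists_isFace_of_mem_polytope hy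
  exact mem_realize.2 ⟨d, hK _ _ hd hc, hyd⟩

/-- For a set of cells closed under faces, the open cells may be replaced by the closed polytopes,
and there are finitely many. -/
theorem isClosed_realize {K : Set (UDCell Γ n)}
    (hK : ∀ c c', c.IsFace c' → c' ∈ K → c ∈ K) : IsClosed (realize K) := by
  have h : realize K = ⋃ c ∈ K, c.polytope :=
    Set.Subset.antisymm (Set.iUnion₂_mono fun c _ y hy => hy.1)
      (Set.iUnion₂_subset fun c hc => polytope_subset_realize hK hc)
  rw [h]
  exact K.toFinite.isClosed_biUnion fun c _ => c.isClosed_polytope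

end UDCell

namespace DConf

theorem weight_mem_interior (x : DConf Γ n) : x.weight ∈ x.cell.interior := by
  refine ⟨⟨fun v => Finset.sum_nonneg fun i _ => (x.1 i).2.1.1 v, fun s hs => ?_, fun v hv => ?_⟩,
    fun s hs v hv => ?_⟩
  · obtain ⟨i, -, rfl⟩ := Finset.mem_image.1 hs
    rw [Finset.sum_congr rfl fun v hv => x.weight_eq hv, ← (x.1 i).2.1.2]
    exact Finset.sum_subset (Finset.subset_univ _) fun v _ hv => by simpa [mem_carrier] using hv
  · refine Finset.sum_eq_zero fun i _ => ?_
    by_contra hne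
    exact hv _ (Finset.mem_image_of_mem _ (Finset.mem_univ i)) (mem_carrier.2 hne)
  · obtain ⟨i, -, rfl⟩ := Finset.mem_image.1 hs
    rw [x.weight_eq hv]
    exact mem_carrier.1 hv

theorem exists_weight_eq {c : UDCell Γ n} {y : V → ℝ} (h : y ∈ c.interior) :
    ∃ x : DConf Γ n, x.weight = y := by
  let e := (Finset.equivFinOfCardEq c.card_cells).symm
  have hc : ∀ i, carrier (fun v => if v ∈ (e i).1 then y v else 0) = (e i).1 := by
    intro i
    ext v
    by_cases hv : v ∈ (e i).1
    · simp [mem_carrier, hv, h.2 _ (e i).2 v hv]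
    · simp [mem_carrier, hv]
  refine ⟨⟨fun i => ⟨fun v => if v ∈ (e i).1 then y v else 0, ⟨fun v => ?_, ?_⟩, ?_⟩, ?_⟩, ?_⟩
  · dsimp only
    split_ifs
    · exact h.1.1 v
    · exact le_rfl
  · rw [← h.1.2.1 _ (e i).2, Finset.sum_ite_mem, Finset.univ_inter]
  · rw [hc]
    exact c.isGraphCell _ (e i).2
  · intro i j hij
    rw [disjoint_closedCellOf_iff]
    dsimp only
    rw [hc, hc]
    exact c.disjoint _ (e i).2 _ (e j).2 fun he => hij (e.injective (Subtype.ext he))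
  · ext v
    by_cases hv : ∃ s ∈ c.cells, v ∈ s
    · obtain ⟨s, hs, hvs⟩ := hv
      have hv' : v ∈ (e (e.symm ⟨s, hs⟩)).1 := by simpa using hvs
      rw [weight_eq _ (i := e.symm ⟨s, hs⟩)]
      · exact if_pos hv'
      · dsimp only
        rw [hc]
        exact hv'
    · push Not at hv
      rw [h.1.2.2 v hv]
      exact Finset.sum_eq_zero fun i _ => if_neg (hv _ (e i).2)

/-- The space is a finite union of products of closed faces of the simplex, one product for each
choice of pairwise disjoint graph cells. Compactness makes the injective `weight` an embedding. -/
instance : CompactSpace (DConf Γ n) := by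
  let f : DConf Γ n → Fin n → V → ℝ := fun x i => (x.1 i).1
  have hf : Topology.IsInducing f :=
    (Topology.IsInducing.piMap fun _ => Topology.IsInducing.subtypeVal).comp
      Topology.IsInducing.subtypeVal
  rw [← isCompact_univ_iff, hf.isCompact_iff, Set.image_univ]
  have hr : Set.range f = ⋃ s ∈ {s : Fin n → Finset V | (∀ i, IsGraphCell Γ (s i)) ∧
      ∀ i j, i ≠ j → Disjoint (s i) (s j)},
      Set.univ.pi fun i => stdSimplex ℝ V ∩ ⋂ v ∈ (s i)ᶜ, {x : V → ℝ | x v = 0} := by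
    ext z
    simp only [Set.mem_range, Set.mem_iUnion, Set.mem_univ_pi]
    constructor
    · rintro ⟨x, rfl⟩
      refine ⟨fun i => carrier (x.1 i).1, ⟨fun i => (x.1 i).2.2, fun i j hij =>
        x.disjoint_carrier hij⟩, fun i => ⟨(x.1 i).2.1, ?_⟩⟩
      simp [mem_carrier, f]
    · rintro ⟨s, ⟨hs, hd⟩, hz⟩
      have hsub : ∀ i, carrier (z i) ⊆ s i := by
        intro i v hv
        by_contra hvs
        have := (hz i).2
        simp only [Set.mem_iInter] at this
        exact mem_carrier.1 hv (this v (by simpa using hvs))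
      have hne : ∀ i, (carrier (z i)).Nonempty := by
        intro i
        by_contra hemp
        rw [Finset.not_nonempty_iff_eq_empty] at hemp
        have h0 : ∑ v, z i v = 0 := Finset.sum_eq_zero fun v _ => by
          by_contra hv
          exact Finset.notMem_empty v (hemp ▸ mem_carrier.2 hv)
        rw [(hz i).1.2] at h0
        exact one_ne_zero h0
      refine ⟨⟨fun i => ⟨z i, (hz i).1, (hs i).subset (hsub i) (hne i)⟩, fun i j hij => ?_⟩, rfl⟩
      rw [disjoint_closedCellOf_iff]
      exact (hd i j hij).mono (hsub i) (hsub j)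
  rw [hr]
  refine (Set.toFinite _).isCompact_biUnion fun s _ => isCompact_univ_pi fun i =>
    (isCompact_stdSimplex ℝ V).inter_right (isClosed_biInter fun v _ => ?_)
  exact isClosed_eq (by fun_prop) (by fun_prop)

theorem weight_congr {x x' : DConf Γ n} (h : (permSetoid Γ n) x x') : x.weight = x'.weight := by
  obtain ⟨σ, hσ⟩ := h
  ext v
  simp only [weight, hσ]
  exact (Equiv.sum_comp σ fun i => (x.1 i).1 v).symm

theorem equiv_of_weight_eq_of_cell_eq {x x' : DConf Γ n} (hw : x.weight = x'.weight)
    (hc : x.cell = x'.cell) : (permSetoid Γ n) x x' := by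
  have hex : ∀ i, ∃ j, carrier (x.1 j).1 = carrier (x'.1 i).1 := by
    intro i
    have : carrier (x'.1 i).1 ∈ x.cell.cells := by
      rw [hc]
      exact Finset.mem_image_of_mem _ (Finset.mem_univ i)
    obtain ⟨j, -, hj⟩ := Finset.mem_image.1 this
    exact ⟨j, hj⟩
  choose σ hσ using hex
  have hinj : Function.Injective σ := fun i j h =>
    x'.carrier_injective (by simp only [← hσ, h])
  refine ⟨Equiv.ofBijective σ (Finite.injective_iff_bijective.1 hinj), fun i => ?_⟩
  apply Subtype.ext
  ext v
  rw [Equiv.ofBijective_apply]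
  by_cases hv : v ∈ carrier (x'.1 i).1
  · rw [← x'.weight_eq hv, ← hw, x.weight_eq (i := σ i) (by rwa [hσ])]
  · have hv' : v ∉ carrier (x.1 (σ i)).1 := by rwa [hσ]
    rw [mem_carrier, not_not] at hv hv'
    rw [hv, hv']

end DConf

namespace UDConf

/-- The sum of the barycentric coordinates of the points of an unordered configuration. -/
noncomputable def weight : UDConf Γ n → V → ℝ :=
  Quotient.lift DConf.weight fun _ _ h => DConf.weight_congr h

theorem continuous_weight : Continuous (weight : UDConf Γ n → V → ℝ) := by
  refine Continuous.quotient_lift (continuous_pi fun v => ?_) _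
  refine continuous_finsetSum _ fun i _ => ?_
  exact (continuous_apply v).comp (continuous_subtype_val.comp
    ((continuous_apply i).comp continuous_subtype_val))

theorem range_weight : Set.range (UDConf.weight : UDConf Γ n → V → ℝ) =
    UDCell.realize (Set.univ : Set (UDCell Γ n)) := by
  ext y
  rw [UDCell.mem_realize]
  constructor
  · rintro ⟨q, rfl⟩
    induction q using Quotient.inductionOn with | _ x =>
    exact ⟨x.cell, trivial, x.weight_mem_interior⟩
  · rintro ⟨c, -, hc⟩
    obtain ⟨x, rfl⟩ := DConf.exists_weight_eq hc
    exact ⟨Quotient.mk _ x, rfl⟩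

end UDConf

end Configurations

/-! ### Injectivity of the coordinates for a tree, and the collapses. -/

namespace DirectionLabelling

open SimpleGraph

variable {V : Type*} [Fintype V] [DecidableEq V] {Γ : SimpleGraph V} [DecidableRel Γ.Adj]
  {root u v w : V} {n : ℕ} {c c' σ τ : UDCell Γ n} {s : Finset V} {y : V → ℝ}

theorem sum_rootEdge (L : DirectionLabelling Γ root) (hΓ : Γ.IsTree) (hv : v ≠ root)
    (y : V → ℝ) : ∑ u ∈ L.rootEdge v, y u = y v + y (Γ.parent root v) :=
  Finset.sum_pair (hΓ.parent_ne hv).symm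

theorem add_parent_eq_one (L : DirectionLabelling Γ root) (hΓ : Γ.IsTree) (h : y ∈ c.polytope)
    (hv : v ≠ root) (he : L.rootEdge v ∈ c.cells) : y v + y (Γ.parent root v) = 1 := by
  rw [← L.sum_rootEdge hΓ hv, h.2.1 _ he]

theorem eq_one_of_singleton_mem (h : y ∈ c.polytope) (hv : {v} ∈ c.cells) : y v = 1 := by
  simpa using h.2.1 _ hv

/-- Some member of `c'` contains `v`. It is not `{v}`, since the parent has positive weight, leaving
`y v < 1`. It is not the edge to a child of `v` either: that deeper edge would also lie in `c` and
meet `e(v)` there. So it is `e(v)`. -/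
theorem rootEdge_mem_of_mem_interior (L : DirectionLabelling Γ root) (hΓ : Γ.IsTree)
    (h : y ∈ c.interior) (h' : y ∈ c'.interior) (hv : v ≠ root) (he : L.rootEdge v ∈ c.cells)
    (hdeep : ∀ u, u ≠ root → Γ.dist root v < Γ.dist root u → L.rootEdge u ∈ c'.cells →
      L.rootEdge u ∈ c.cells) : L.rootEdge v ∈ c'.cells := by
  have hsum := L.add_parent_eq_one hΓ h.1 hv he
  have hpar := h.2 _ he _ L.parent_mem_rootEdge
  obtain ⟨s, hs, hvs⟩ := UDCell.exists_mem_of_ne_zero h'.1 (h.2 _ he _ L.self_mem_rootEdge)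
  rcases L.cases_of_isGraphCell hΓ (c'.isGraphCell s hs) with ⟨u, rfl⟩ | ⟨u, hu, rfl⟩
  · obtain rfl := Finset.mem_singleton.1 hvs
    have := eq_one_of_singleton_mem h'.1 hs
    exact absurd (by linarith) hpar
  · rcases L.mem_rootEdge.1 hvs with rfl | rfl
    · exact hs
    · have hd := hΓ.dist_parent hu
      have hmem := hdeep u hu (by omega) hs
      have := L.rootEdge_inj hΓ hu hv
        (c.eq_of_mem_of_mem hmem he L.parent_mem_rootEdge L.self_mem_rootEdge)
      exact absurd this.symm (hΓ.parent_ne hu)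

/-- Induction from the deepest edges towards the root. On a 4-cycle this fails: the constant weight
`1/2` comes from both pairs of opposite edges. -/
theorem rootEdge_mem_iff_of_mem_interior (L : DirectionLabelling Γ root) (hΓ : Γ.IsTree)
    (h : y ∈ c.interior) (h' : y ∈ c'.interior) (hv : v ≠ root) :
    L.rootEdge v ∈ c.cells ↔ L.rootEdge v ∈ c'.cells := by
  induction hk : Finset.univ.sup (Γ.dist root) - Γ.dist root v using Nat.strong_induction_on
    generalizing v with
  | _ k ih =>
    have key : ∀ u, u ≠ root → Γ.dist root v < Γ.dist root u →
        (L.rootEdge u ∈ c.cells ↔ L.rootEdge u ∈ c'.cells) := by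
      intro u hu hd
      have := Finset.le_sup (f := Γ.dist root) (Finset.mem_univ u)
      exact ih _ (by omega) hu rfl
    exact ⟨fun he => L.rootEdge_mem_of_mem_interior hΓ h h' hv he fun u hu hd => (key u hu hd).2,
      fun he => L.rootEdge_mem_of_mem_interior hΓ h' h hv he fun u hu hd => (key u hu hd).1⟩

theorem cells_subset_of_mem_interior (L : DirectionLabelling Γ root) (hΓ : Γ.IsTree)
    (h : y ∈ c.interior) (h' : y ∈ c'.interior) : c.cells ⊆ c'.cells := by
  intro s hs
  rcases L.cases_of_isGraphCell hΓ (c.isGraphCell s hs) with ⟨v, rfl⟩ | ⟨v, hv, rfl⟩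
  · obtain ⟨t, ht, hvt⟩ := UDCell.exists_mem_of_ne_zero h'.1 (h.2 _ hs v (by simp))
    rcases L.cases_of_isGraphCell hΓ (c'.isGraphCell t ht) with ⟨u, rfl⟩ | ⟨u, hu, rfl⟩
    · rwa [Finset.mem_singleton.1 hvt]
    · have := (L.rootEdge_mem_iff_of_mem_interior hΓ h h' hu).2 ht
      rwa [c.eq_of_mem_of_mem hs this (Finset.mem_singleton_self v) hvt]
  · exact (L.rootEdge_mem_iff_of_mem_interior hΓ h h' hv).1 hs

/-- In a tree, the sum of the coordinates determines the cell of a configuration. -/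
theorem eq_of_mem_interior (L : DirectionLabelling Γ root) (hΓ : Γ.IsTree)
    (h : y ∈ c.interior) (h' : y ∈ c'.interior) : c = c' :=
  UDCell.ext ((L.cells_subset_of_mem_interior hΓ h h').antisymm
    (L.cells_subset_of_mem_interior hΓ h' h))

theorem weight_injective (L : DirectionLabelling Γ root) (hΓ : Γ.IsTree) :
    Function.Injective (UDConf.weight : UDConf Γ n → V → ℝ) := by
  intro q q' h
  induction q using Quotient.inductionOn with | _ x =>
  induction q' using Quotient.inductionOn with | _ x' =>
  have hw : x.weight = x'.weight := h
  exact Quotient.sound (DConf.equiv_of_weight_eq_of_cell_eq hw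
    (L.eq_of_mem_interior hΓ x.weight_mem_interior (hw ▸ x'.weight_mem_interior)))

theorem isEmbedding_weight (L : DirectionLabelling Γ root) (hΓ : Γ.IsTree) :
    Topology.IsEmbedding (UDConf.weight : UDConf Γ n → V → ℝ) :=
  (UDConf.continuous_weight.isClosedEmbedding (L.weight_injective hΓ)).isEmbedding

theorem mem_openCell_iff (L : DirectionLabelling Γ root) (hΓ : Γ.IsTree) {q : UDConf Γ n} :
    q ∈ c.openCell ↔ q.weight ∈ c.interior := by
  constructor
  · rintro ⟨x, rfl, hx⟩
    have : x.cell = c := UDCell.ext hx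
    exact this ▸ x.weight_mem_interior
  · induction q using Quotient.inductionOn with | _ x =>
    intro h
    have := L.eq_of_mem_interior hΓ x.weight_mem_interior h
    exact ⟨x, rfl, congrArg UDCell.cells this⟩

/-! ### The elementary collapse of a cell from a free face

The closed cell of `τ` is projected from a point beyond the face where the coordinate at the parent
of `v` vanishes. -/

/-- The point from which the closed cell of `τ` is projected. -/
noncomputable def center (_L : DirectionLabelling Γ root) (τ : UDCell Γ n) (v : V) : V → ℝ :=
  -- On `e(v)` use the coordinate `t` at the parent of `v`: the free face is `t = 0`, and the center
  -- has `t = -1`, hence `2` at `v` to keep the sum 1. Every other edge has its midpoint `1/2`.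
  fun u => if u = v then 2 else if u = Γ.parent root v then -1 else
    if {u} ∈ τ.cells then 1 else if u ∈ τ.cells.sup id then 1 / 2 else 0

/-- The difference of the coordinates at the ends of the edge below `u`, for the edges of `τ` other
than the edge below `v`. -/
noncomputable def edgeDiff (L : DirectionLabelling Γ root) (τ : UDCell Γ n) (v : V)
    (y : V → ℝ) : V → ℝ :=
  fun u => if u ∈ (L.edgeTops τ).erase v then y u - y (Γ.parent root u) else 0

/-- The factor by which a point of the closed cell of `τ` is closer to the center than the
boundary. -/
noncomputable def gauge (L : DirectionLabelling Γ root) (τ : UDCell Γ n) (v : V)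
    (y : V → ℝ) : ℝ :=
  -- Distances from the center relative to the walls: `t + 1` out of 2 for the wall `t = 1`, and `|y
  -- u - 1/2|` out of `1/2` for the ends of another edge, which equals the difference of its two
  -- coordinates in absolute value. There is no wall at `t = 0`.
  max ((1 + y (Γ.parent root v)) / 2) ‖L.edgeDiff τ v y‖

/-- The central projection of the closed cell of `τ` to its boundary. -/
noncomputable def proj (L : DirectionLabelling Γ root) (τ : UDCell Γ n) (v : V)
    (y : V → ℝ) : V → ℝ :=
  L.center τ v + (L.gauge τ v y)⁻¹ • (y - L.center τ v)

theorem center_self (L : DirectionLabelling Γ root) : L.center τ v v = 2 := by simp [center]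

theorem center_parent (L : DirectionLabelling Γ root) (hΓ : Γ.IsTree) (hv : v ≠ root) :
    L.center τ v (Γ.parent root v) = -1 := by
  simp [center, hΓ.parent_ne hv]

theorem center_of_notMem_rootEdge (L : DirectionLabelling Γ root)
    (hu : u ∉ L.rootEdge v) : L.center τ v u =
      if {u} ∈ τ.cells then 1 else if u ∈ τ.cells.sup id then 1 / 2 else 0 := by
  rw [L.mem_rootEdge, not_or] at hu
  rw [center, if_neg hu.1, if_neg hu.2]

theorem center_of_singleton_mem (L : DirectionLabelling Γ root) (hΓ : Γ.IsTree) (hv : v ≠ root)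
    (he : L.rootEdge v ∈ τ.cells) (hu : {u} ∈ τ.cells) : L.center τ v u = 1 := by
  rw [L.center_of_notMem_rootEdge, if_pos hu]
  intro h
  exact L.rootEdge_ne_singleton hΓ hv (τ.eq_of_mem_of_mem he hu h (Finset.mem_singleton_self u))

theorem center_of_mem_rootEdge (L : DirectionLabelling Γ root) (hΓ : Γ.IsTree) (hv : v ≠ root)
    (he : L.rootEdge v ∈ τ.cells) (hw : w ∈ (L.edgeTops τ).erase v) (hu : u ∈ L.rootEdge w) :
    L.center τ v u = 1 / 2 := by
  rw [Finset.mem_erase, L.mem_edgeTops] at hw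
  rw [L.center_of_notMem_rootEdge, if_neg, if_pos]
  · exact Finset.mem_sup.2 ⟨_, hw.2.2, hu⟩
  · intro h
    exact L.rootEdge_ne_singleton hΓ hw.2.1
      (τ.eq_of_mem_of_mem hw.2.2 h hu (Finset.mem_singleton_self u))
  · intro h
    exact hw.1 (L.rootEdge_inj hΓ hw.2.1 hv (τ.eq_of_mem_of_mem hw.2.2 he hu h))

theorem continuous_edgeDiff (L : DirectionLabelling Γ root) : Continuous (L.edgeDiff τ v) := by
  refine continuous_pi fun u => ?_
  by_cases hu : u ∈ (L.edgeTops τ).erase v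
  · simp only [edgeDiff, if_pos hu]; fun_prop
  · simp only [edgeDiff, if_neg hu]; fun_prop

theorem continuous_gauge (L : DirectionLabelling Γ root) : Continuous (L.gauge τ v) := by
  have := L.continuous_edgeDiff (τ := τ) (v := v)
  unfold gauge
  fun_prop

/-- The center lies outside the polytope, so the gauge stays away from 0 and `proj` is continuous
there. -/
theorem half_le_gauge (L : DirectionLabelling Γ root) (h : y ∈ c.polytope) :
    1 / 2 ≤ L.gauge τ v y := by
  have := h.1 (Γ.parent root v)
  exact le_max_of_le_left (by linarith)

theorem continuousOn_proj (L : DirectionLabelling Γ root) :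
    ContinuousOn (L.proj τ v) τ.polytope := by
  refine continuousOn_const.add (ContinuousOn.smul (L.continuous_gauge.continuousOn.inv₀ ?_)
    (by fun_prop))
  intro y hy
  have := L.half_le_gauge (τ := τ) (v := v) hy
  positivity

theorem edgeDiff_of_mem (L : DirectionLabelling Γ root) (hu : u ∈ (L.edgeTops τ).erase v) :
    L.edgeDiff τ v y u = y u - y (Γ.parent root u) := if_pos hu

theorem abs_sub_le_gauge (L : DirectionLabelling Γ root) (hu : u ∈ (L.edgeTops τ).erase v) :
    |y u - y (Γ.parent root u)| ≤ L.gauge τ v y := by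
  have := norm_le_pi_norm (L.edgeDiff τ v y) u
  rw [L.edgeDiff_of_mem hu, Real.norm_eq_abs] at this
  exact this.trans (le_max_right _ _)

theorem gauge_le_one (L : DirectionLabelling Γ root) (hΓ : Γ.IsTree) (hv : v ≠ root)
    (he : L.rootEdge v ∈ τ.cells) (h : y ∈ τ.polytope) : L.gauge τ v y ≤ 1 := by
  have h1 := L.add_parent_eq_one hΓ h hv he
  have h2 := h.1 v
  refine max_le (by linarith) ((pi_norm_le_iff_of_nonneg zero_le_one).2 fun u => ?_)
  by_cases hu : u ∈ (L.edgeTops τ).erase v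
  · have hu' := L.mem_edgeTops.1 (Finset.mem_of_mem_erase hu)
    have h3 := L.add_parent_eq_one hΓ h hu'.1 hu'.2
    have h4 := h.1 u
    have h5 := h.1 (Γ.parent root u)
    rw [L.edgeDiff_of_mem hu, Real.norm_eq_abs, abs_le]
    constructor <;> linarith
  · simp [edgeDiff, hu]

theorem proj_apply (L : DirectionLabelling Γ root) : L.proj τ v y u =
    L.center τ v u + (L.gauge τ v y)⁻¹ * (y u - L.center τ v u) := rfl

theorem proj_of_gauge_eq_one (L : DirectionLabelling Γ root) (h : L.gauge τ v y = 1) :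
    L.proj τ v y = y := by
  simp [proj, h]

theorem proj_of_singleton_mem (L : DirectionLabelling Γ root) (hΓ : Γ.IsTree) (hv : v ≠ root)
    (he : L.rootEdge v ∈ τ.cells) (h : y ∈ τ.polytope) (hu : {u} ∈ τ.cells) :
    L.proj τ v y u = 1 := by
  rw [proj_apply, L.center_of_singleton_mem hΓ hv he hu, eq_one_of_singleton_mem h hu]
  simp

/-- The gauge is homogeneous about the center, so dividing the displacement by it scales the gauge
to 1. -/
theorem gauge_proj (L : DirectionLabelling Γ root) (hΓ : Γ.IsTree) (hv : v ≠ root)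
    (he : L.rootEdge v ∈ τ.cells) (h : y ∈ τ.polytope) :
    L.gauge τ v (L.proj τ v y) = 1 := by
  have hpos : 0 < L.gauge τ v y := by linarith [L.half_le_gauge (τ := τ) (v := v) h]
  have hdiff : L.edgeDiff τ v (L.proj τ v y) = (L.gauge τ v y)⁻¹ • L.edgeDiff τ v y := by
    ext u
    by_cases hu : u ∈ (L.edgeTops τ).erase v
    · rw [Pi.smul_apply, L.edgeDiff_of_mem hu, L.edgeDiff_of_mem hu, proj_apply, proj_apply,
        L.center_of_mem_rootEdge hΓ hv he hu L.self_mem_rootEdge,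
        L.center_of_mem_rootEdge hΓ hv he hu L.parent_mem_rootEdge, smul_eq_mul]
      ring
    · simp [edgeDiff, hu]
  rw [gauge, hdiff, proj_apply, L.center_parent hΓ hv, norm_smul,
    Real.norm_of_nonneg (inv_nonneg.2 hpos.le)]
  have : (1 + (-1 + (L.gauge τ v y)⁻¹ * (y (Γ.parent root v) - -1))) / 2 =
      (L.gauge τ v y)⁻¹ * ((1 + y (Γ.parent root v)) / 2) := by ring
  rw [this, ← mul_max_of_nonneg _ _ (inv_nonneg.2 hpos.le)]
  exact inv_mul_cancel₀ hpos.ne'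

theorem proj_mem_polytope (L : DirectionLabelling Γ root) (hΓ : Γ.IsTree) (hv : v ≠ root)
    (he : L.rootEdge v ∈ τ.cells) (h : y ∈ τ.polytope) : L.proj τ v y ∈ τ.polytope := by
  have hpos : 0 < L.gauge τ v y := by linarith [L.half_le_gauge (τ := τ) (v := v) h]
  have hone : 1 ≤ (L.gauge τ v y)⁻¹ :=
    (one_le_inv₀ hpos).2 (L.gauge_le_one hΓ hv he h)
  have hcancel := inv_mul_cancel₀ hpos.ne'
  have hleft : (1 + y (Γ.parent root v)) / 2 ≤ L.gauge τ v y := le_max_left _ _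
  have hleft' := mul_le_mul_of_nonneg_left hleft (inv_nonneg.2 hpos.le)
  have habs : ∀ x ∈ (L.edgeTops τ).erase v,
      |(L.gauge τ v y)⁻¹ * (y x - y (Γ.parent root x))| ≤ 1 := by
    intro x hx
    rw [abs_mul, abs_of_pos (inv_pos.2 hpos), ← hcancel]
    exact mul_le_mul_of_nonneg_left (L.abs_sub_le_gauge hx) (inv_nonneg.2 hpos.le)
  set a := (L.gauge τ v y)⁻¹
  have hsum := L.add_parent_eq_one hΓ h hv he
  have hzero : ∀ u, (∀ s ∈ τ.cells, u ∉ s) → L.proj τ v y u = 0 := by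
    intro u hu
    rw [proj_apply, h.2.2 u hu, L.center_of_notMem_rootEdge (hu _ he), if_neg, if_neg]
    · simp
    · rw [Finset.mem_sup]
      push Not
      exact hu
    · exact fun hmem => hu _ hmem (Finset.mem_singleton_self u)
  have hself : L.proj τ v y v = 2 + a * (y v - 2) := by rw [proj_apply, L.center_self]
  have hpar : L.proj τ v y (Γ.parent root v) = -1 + a * (y (Γ.parent root v) + 1) := by
    rw [proj_apply, L.center_parent hΓ hv, sub_neg_eq_add]
  have hedge : ∀ x ∈ (L.edgeTops τ).erase v, ∀ u ∈ L.rootEdge x,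
      L.proj τ v y u = 1 / 2 + a * (y u - 1 / 2) := by
    intro x hx u hu
    rw [proj_apply, L.center_of_mem_rootEdge hΓ hv he hx hu]
  refine ⟨fun u => ?_, fun s hs => ?_, hzero⟩
  · by_cases hu : ∀ s ∈ τ.cells, u ∉ s
    · exact (hzero u hu).ge
    push Not at hu
    obtain ⟨s, hs, hus⟩ := hu
    rcases L.cases_of_isGraphCell hΓ (τ.isGraphCell s hs) with ⟨x, rfl⟩ | ⟨x, hx, rfl⟩
    · obtain rfl := Finset.mem_singleton.1 hus
      rw [L.proj_of_singleton_mem hΓ hv he h hs]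
      exact zero_le_one
    by_cases hxv : x = v
    · subst hxv
      rcases L.mem_rootEdge.1 hus with rfl | rfl
      · have : y u = 1 - y (Γ.parent root u) := by linarith
        rw [hself, this]
        linarith
      · rw [hpar]
        have := h.1 (Γ.parent root x)
        nlinarith
    · have hx' : x ∈ (L.edgeTops τ).erase v :=
        Finset.mem_erase.2 ⟨hxv, L.mem_edgeTops.2 ⟨hx, hs⟩⟩
      have h1 := L.add_parent_eq_one hΓ h hx hs
      have h2 := abs_le.1 (habs x hx')
      rw [hedge x hx' u hus]
      rcases L.mem_rootEdge.1 hus with rfl | rfl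
      · have : y (Γ.parent root u) = 1 - y u := by linarith
        rw [this] at h2
        linarith
      · have : y x = 1 - y (Γ.parent root x) := by linarith
        rw [this] at h2
        linarith
  · rcases L.cases_of_isGraphCell hΓ (τ.isGraphCell s hs) with ⟨x, rfl⟩ | ⟨x, hx, rfl⟩
    · rw [Finset.sum_singleton, L.proj_of_singleton_mem hΓ hv he h hs]
    have h1 := L.add_parent_eq_one hΓ h hx hs
    rw [L.sum_rootEdge hΓ hx]
    by_cases hxv : x = v
    · subst hxv
      rw [hself, hpar]
      linear_combination a * h1
    · have hx' : x ∈ (L.edgeTops τ).erase v :=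
        Finset.mem_erase.2 ⟨hxv, L.mem_edgeTops.2 ⟨hx, hs⟩⟩
      rw [hedge x hx' x L.self_mem_rootEdge, hedge x hx' _ L.parent_mem_rootEdge]
      linear_combination a * h1

theorem norm_edgeDiff_lt_one (L : DirectionLabelling Γ root) (hΓ : Γ.IsTree)
    (h : y ∈ c.polytope) (hne : ∀ s ∈ c.cells, ∀ u ∈ s, y u ≠ 0)
    (hmem : ∀ u ∈ (L.edgeTops τ).erase v, L.rootEdge u ∈ c.cells) :
    ‖L.edgeDiff τ v y‖ < 1 := by
  refine (pi_norm_lt_iff zero_lt_one).2 fun u => ?_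
  by_cases hu : u ∈ (L.edgeTops τ).erase v
  · have hu' := L.mem_edgeTops.1 (Finset.mem_of_mem_erase hu)
    have h3 := L.add_parent_eq_one hΓ h hu'.1 (hmem u hu)
    have h4 := (h.1 u).lt_of_ne (hne _ (hmem u hu) u L.self_mem_rootEdge).symm
    have h5 := (h.1 _).lt_of_ne (hne _ (hmem u hu) _ L.parent_mem_rootEdge).symm
    rw [L.edgeDiff_of_mem hu, Real.norm_eq_abs, abs_lt]
    constructor <;> linarith
  · simp [edgeDiff, hu]

namespace IsElementaryReduction

variable {L : DirectionLabelling Γ root}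

theorem parent_eq_zero (h : L.IsElementaryReduction σ v τ) (hΓ : Γ.IsTree)
    (hy : y ∈ σ.polytope) : y (Γ.parent root v) = 0 := by
  refine hy.2.2 _ fun s hs hps => ?_
  by_cases hsv : s = {v}
  · rw [hsv, Finset.mem_singleton] at hps
    exact hΓ.parent_ne h.1.2.1 hps
  · exact Finset.disjoint_left.1 (h.1.2.2 s hs hsv) L.parent_mem_rootEdge hps

theorem polytope_subset (h : L.IsElementaryReduction σ v τ) (hΓ : Γ.IsTree) :
    σ.polytope ⊆ τ.polytope := by
  intro y hy
  refine ⟨hy.1, fun s hs => ?_, fun u hu => hy.2.2 u fun s hs hus => ?_⟩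
  · rcases h.mem_iff.1 hs with rfl | hs'
    · rw [L.sum_rootEdge hΓ h.1.2.1, h.parent_eq_zero hΓ hy, eq_one_of_singleton_mem hy h.1.1,
        add_zero]
    · exact hy.2.1 s hs'.2
  · rcases (h.mem_iff' hΓ).1 hs with rfl | hs'
    · rw [Finset.mem_singleton] at hus
      exact hu _ h.rootEdge_mem (hus ▸ L.self_mem_rootEdge)
    · exact hu s hs'.2 hus

theorem gauge_lt_one (h : L.IsElementaryReduction σ v τ) (hΓ : Γ.IsTree)
    (hy : y ∈ σ.interior ∨ y ∈ τ.interior) : L.gauge τ v y < 1 := by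
  rcases hy with hy | hy
  · refine max_lt ?_ (L.norm_edgeDiff_lt_one hΓ hy.1 hy.2 fun u hu => ?_)
    · rw [h.parent_eq_zero hΓ hy.1]; norm_num
    · rw [Finset.mem_erase, L.mem_edgeTops] at hu
      exact (h.mem_iff' hΓ).2
        (.inr ⟨fun he => hu.1 (L.rootEdge_inj hΓ hu.2.1 h.1.2.1 he), hu.2.2⟩)
  · refine max_lt ?_ (L.norm_edgeDiff_lt_one hΓ hy.1 hy.2 fun u hu =>
      (L.mem_edgeTops.1 (Finset.mem_of_mem_erase hu)).2)
    have h1 := L.add_parent_eq_one hΓ hy.1 h.1.2.1 h.rootEdge_mem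
    have h2 := (hy.1.1 v).lt_of_ne (hy.2 _ h.rootEdge_mem v L.self_mem_rootEdge).symm
    linarith

/-- With `gauge_lt_one`, the part of the polytope of `τ` where the gauge is below 1 is exactly the
two open cells to be removed. All weights on members of `τ` are nonzero except possibly that at the
parent of `v`; its vanishing distinguishes `σ` from `τ`. -/
theorem mem_interior_of_gauge_lt_one (h : L.IsElementaryReduction σ v τ) (hΓ : Γ.IsTree)
    (hy : y ∈ τ.polytope) (hlt : L.gauge τ v y < 1) : y ∈ σ.interior ∨ y ∈ τ.interior := by
  have hw : (1 + y (Γ.parent root v)) / 2 < 1 := (le_max_left _ _).trans_lt hlt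
  have h1 := L.add_parent_eq_one hΓ hy h.1.2.1 h.rootEdge_mem
  have hv0 : y v ≠ 0 := by
    intro h0
    linarith
  have hother : ∀ s ∈ τ.cells, s ≠ L.rootEdge v → ∀ u ∈ s, y u ≠ 0 := by
    intro s hs hne u hu
    rcases L.cases_of_isGraphCell hΓ (τ.isGraphCell s hs) with ⟨x, rfl⟩ | ⟨x, hx, rfl⟩
    · rw [Finset.mem_singleton.1 hu, eq_one_of_singleton_mem hy hs]
      exact one_ne_zero
    · have hx' : x ∈ (L.edgeTops τ).erase v :=
        Finset.mem_erase.2 ⟨fun he => hne (by rw [he]), L.mem_edgeTops.2 ⟨hx, hs⟩⟩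
      have h2 := abs_lt.1 ((L.abs_sub_le_gauge hx').trans_lt hlt)
      have h3 := L.add_parent_eq_one hΓ hy hx hs
      intro h0
      rcases L.mem_rootEdge.1 hu with rfl | rfl <;> linarith
  by_cases hp : y (Γ.parent root v) = 0
  · left
    refine ⟨⟨hy.1, fun s hs => ?_, fun u hu => ?_⟩, fun s hs u hu => ?_⟩
    · rcases (h.mem_iff' hΓ).1 hs with rfl | hs'
      · rw [Finset.sum_singleton]
        linarith
      · exact hy.2.1 s hs'.2
    · by_contra h0
      obtain ⟨s, hs, hus⟩ := UDCell.exists_mem_of_ne_zero hy h0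
      rcases h.mem_iff.1 hs with rfl | hs'
      · rcases L.mem_rootEdge.1 hus with rfl | rfl
        · exact hu _ h.1.1 (Finset.mem_singleton_self u)
        · exact h0 hp
      · exact hu s hs'.2 hus
    · rcases (h.mem_iff' hΓ).1 hs with rfl | hs'
      · rwa [Finset.mem_singleton.1 hu]
      · exact hother s hs'.2 hs'.1 u hu
  · right
    refine ⟨hy, fun s hs u hu => ?_⟩
    by_cases hsv : s = L.rootEdge v
    · rw [hsv] at hu
      rcases L.mem_rootEdge.1 hu with rfl | rfl
      · exact hv0
      · exact hp
    · exact hother s hs hsv u hu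

/-- An elementary collapse of a set of cells, realized by a map. -/
theorem exists_retraction (h : L.IsElementaryReduction σ v τ) (hΓ : Γ.IsTree)
    {K : Set (UDCell Γ n)} (hK : ∀ c c', c.IsFace c' → c' ∈ K → c ∈ K) (hτ : τ ∈ K)
    (hK' : ∀ c c', c.IsFace c' → c' ∈ K \ {σ, τ} → c ∈ K \ {σ, τ}) :
    ∃ r : (V → ℝ) → V → ℝ, ContinuousOn r (UDCell.realize K) ∧
      (∀ y ∈ UDCell.realize K, r y ∈ UDCell.realize (K \ {σ, τ})) ∧
      (∀ y ∈ UDCell.realize (K \ {σ, τ}), r y = y) ∧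
      ∀ y ∈ UDCell.realize K, segment ℝ y (r y) ⊆ UDCell.realize K := by
  classical
  have hmem : ∀ y ∈ UDCell.realize K, y ∈ τ.polytope ∨ y ∈ UDCell.realize (K \ {σ, τ}) := by
    intro y hy
    obtain ⟨c, hc, hyc⟩ := UDCell.mem_realize.1 hy
    by_cases hcσ : c = σ
    · exact .inl (h.polytope_subset hΓ (hcσ ▸ hyc.1))
    by_cases hcτ : c = τ
    · exact .inl (hcτ ▸ hyc.1)
    · exact .inr (UDCell.mem_realize.2 ⟨c, ⟨hc, by simp [hcσ, hcτ]⟩, hyc⟩)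
  have hout : ∀ y ∈ UDCell.realize (K \ {σ, τ}), ¬ (y ∈ σ.interior ∨ y ∈ τ.interior) := by
    intro y hy
    obtain ⟨c, hc, hyc⟩ := UDCell.mem_realize.1 hy
    rintro (hy' | hy')
    · exact hc.2 (.inl (L.eq_of_mem_interior hΓ hyc hy'))
    · exact hc.2 (.inr (L.eq_of_mem_interior hΓ hyc hy'))
  have hid : ∀ y ∈ UDCell.realize (K \ {σ, τ}), y ∈ τ.polytope → L.proj τ v y = y := by
    intro y hy hyτ
    refine L.proj_of_gauge_eq_one (le_antisymm
      (L.gauge_le_one hΓ h.1.2.1 h.rootEdge_mem hyτ) (not_lt.1 fun hlt => ?_))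
    exact hout y hy (h.mem_interior_of_gauge_lt_one hΓ hyτ hlt)
  refine ⟨fun y => if y ∈ τ.polytope then L.proj τ v y else y, ?_, fun y hy => ?_,
    fun y hy => ?_, fun y hy => ?_⟩
  -- Two closed pieces, on whose overlap the projection is the identity.
  · refine ContinuousOn.mono (s := τ.polytope ∪ UDCell.realize (K \ {σ, τ})) ?_ hmem
    refine ContinuousOn.union_of_isClosed ?_ ?_ τ.isClosed_polytope (UDCell.isClosed_realize hK')
    · exact L.continuousOn_proj.congr fun y hy => if_pos hy
    · refine continuousOn_id.congr fun y hy => ?_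
      split_ifs with hyτ
      · exact hid y hy hyτ
      · rfl
  · dsimp only
    split_ifs with hyτ
    · have hp := L.proj_mem_polytope hΓ h.1.2.1 h.rootEdge_mem hyτ
      obtain ⟨c, hc, hyc⟩ := UDCell.mem_realize.1 (UDCell.polytope_subset_realize hK hτ hp)
      refine UDCell.mem_realize.2 ⟨c, ⟨hc, fun hmem => ?_⟩, hyc⟩
      -- If the image were in one of the removed open cells its gauge would be below 1, but
      -- projected points have gauge 1.
      have hlt : L.gauge τ v (L.proj τ v y) < 1 := by
        apply h.gauge_lt_one hΓ
        rcases hmem with rfl | he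
        · exact .inl hyc
        · obtain rfl : c = τ := he
          exact .inr hyc
      rw [L.gauge_proj hΓ h.1.2.1 h.rootEdge_mem hyτ] at hlt
      exact lt_irrefl _ hlt
    · exact (hmem y hy).resolve_left hyτ
  · dsimp only
    split_ifs with hyτ
    · exact hid y hy hyτ
    · rfl
  · dsimp only
    split_ifs with hyτ
    · exact (τ.convex_polytope.segment_subset hyτ
        (L.proj_mem_polytope hΓ h.1.2.1 h.rootEdge_mem hyτ)).trans
        (UDCell.polytope_subset_realize hK hτ)
    · rw [segment_same]
      exact Set.singleton_subset_iff.2 hy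

end IsElementaryReduction

/-- The collapse of a set of cells to the cells of `(UDⁿΓ)'ₖ`. -/
theorem retracts_of_homotopicRel (L : DirectionLabelling Γ root) (hΓ : Γ.IsTree) {k : ℕ}
    (hcrit : ∀ c : UDCell Γ n, L.IsCritical c → c.dim ≤ k) (K : Set (UDCell Γ n))
    (hred : ∀ c c' v, L.Matched c v c' → c ∈ K → k ≤ c.dim → c' ∈ K)
    (hlow : ∀ c c', c.IsFace c' → c' ∈ K → c ∈ K)
    (hskel : ∀ c : UDCell Γ n, c.dim ≤ k ∧ ¬ (c.dim = k ∧ L.IsRedundant c) → c ∈ K)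
    (R : C(UDConf Γ n, UDConf Γ n)) (hR : ∀ q, (R q).weight ∈ UDCell.realize K)
    (hhom : (ContinuousMap.id _).HomotopicRel R (L.skeletonPrime n k)) :
    StrongDeformationRetractsOnto (UDConf Γ n) (L.skeletonPrime n k) := by
  induction hcard : K.ncard using Nat.strong_induction_on generalizing K R with
  | _ m ih =>
    by_cases hex : ∃ c ∈ K, ¬ (c.dim ≤ k ∧ ¬ (c.dim = k ∧ L.IsRedundant c))
    · obtain ⟨σ, v, τ, hm, hσ, hτ, hkσ, hfσ, hfτ⟩ := L.exists_free_face hΓ hcrit K hred hlow hex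
      have hlow' : ∀ c c', c.IsFace c' → c' ∈ K \ {σ, τ} → c ∈ K \ {σ, τ} := by
        intro c c' hf hc'
        refine ⟨hlow c c' hf hc'.1, ?_⟩
        rintro (rfl | he)
        · exact hc'.2 (hfσ c' hc'.1 hf)
        · obtain rfl : c = τ := he
          exact hc'.2 (.inr (hfτ c' hc'.1 hf))
      obtain ⟨r, hrc, hrK, hrid, hrseg⟩ := hm.1.exists_retraction hΓ hlow hτ hlow'
      have hskel' : ∀ c : UDCell Γ n, c.dim ≤ k ∧ ¬ (c.dim = k ∧ L.IsRedundant c) →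
          c ∈ K \ {σ, τ} := by
        intro c hc
        refine ⟨hskel c hc, ?_⟩
        rintro (rfl | he)
        · exact hc.2 ⟨le_antisymm hc.1 hkσ, (L.isRedundant_iff hΓ).2 ⟨v, τ, hm⟩⟩
        · obtain rfl : c = τ := he
          have := hm.1.dim_eq hΓ
          omega
      obtain ⟨R', hR', hhom'⟩ := ContinuousMap.exists_homotopicRel_of_segment_subset
        (L.isEmbedding_weight hΓ) (A := L.skeletonPrime n k) R hR hrc
        (fun y hy => (hrseg y hy).trans (by
          rw [UDConf.range_weight]
          exact Set.biUnion_mono (Set.subset_univ K) fun _ _ => subset_rfl))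
        (fun q hq => by
          have hq' : R q = q := (hhom.fst_eq_snd hq).symm
          rw [hq']
          obtain ⟨c, hqc, hc⟩ := hq
          exact hrid _ (UDCell.mem_realize.2 ⟨c, hskel' c hc, (L.mem_openCell_iff hΓ).1 hqc⟩))
      refine ih (K \ {σ, τ}).ncard ?_ (K \ {σ, τ}) ?_ hlow' hskel' R' (fun q => ?_)
        (hhom.trans hhom') rfl
      · rw [← hcard]
        exact Set.ncard_lt_ncard ⟨Set.sdiff_subset, fun hs => (hs hσ).2 (.inl rfl)⟩ K.toFinite
      -- Pairs are disjoint, so deleting one leaves every other partner in place.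
      · intro c c' u hcc hc hk
        refine ⟨hred c c' u hcc hc.1 hk, ?_⟩
        rintro (rfl | he)
        · exact hcc.not_matched hΓ hm
        · obtain rfl : c' = τ := he
          exact hc.2 (.inl (hcc.left_unique hΓ hm))
      · rw [hR']
        exact hrK _ (hR q)
    -- Now every cell of `K` belongs to the desired subcomplex, so `R` is the final map of the
    -- deformation.
    · push Not at hex
      refine ⟨R, fun q => ?_, hhom⟩
      obtain ⟨c, hc, hqc⟩ := UDCell.mem_realize.1 (hR q)
      have := hex c hc
      exact ⟨c, (L.mem_openCell_iff hΓ).2 hqc, this.1, fun h => this.2 h.1 h.2⟩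

end DirectionLabelling

theorem theorem4p3 {V : Type*} [Fintype V] [DecidableEq V] (Γ : SimpleGraph V)
    [DecidableRel Γ.Adj] (hΓ : Γ.IsTree) (root : V) (hroot : Γ.degree root = 1)
    (L : DirectionLabelling Γ root) (n k : ℕ)
    (hk : k = min (n / 2) (Finset.univ.filter fun v : V => 3 ≤ Γ.degree v).card) :
    (∀ c : UDCell Γ n, L.IsCritical c → c.dim ≤ k) ∧
      StrongDeformationRetractsOnto (UDConf Γ n) (L.skeletonPrime n k) := by
  have hcrit : ∀ c : UDCell Γ n, L.IsCritical c → c.dim ≤ k := by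
    intro c hc
    have h1 := hc.two_mul_dim_le hΓ
    have h2 := hc.dim_le_card_essential hΓ hroot
    rw [hk]
    exact le_min (by omega) h2
  refine ⟨hcrit, L.retracts_of_homotopicRel hΓ hcrit Set.univ (fun _ _ _ _ _ _ => trivial)
    (fun _ _ _ _ => trivial) (fun _ _ => trivial) (ContinuousMap.id _) (fun q => ?_)
    (ContinuousMap.HomotopicRel.refl _)⟩
  rw [← UDConf.range_weight]
  exact Set.mem_range_self q
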